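/- For Polish spaces $X,Y$ and equivalence relations $E$ on $X$ and $F$ on $Y$, write $E\le_B F$ if there is a Borel function $\theta:X\to Y$ such that $x\,E\,y\iff\theta(x)\,F\,\theta(y)$ for all $x,y\in X$, and write $E\sim_B F$ if $E\le_B F$ and $F\le_B E$. For a separable Banach space $X$ and $p\in[1,+\infty)$, let $E(X,p)$ be the equivalence relation on $X^{\mathbb N}$ given by $$(x,y)\in E(X,p)\iff\sum_{n\in\mathbb N}\|x(n)-y(n)\|_X^p<+\infty .$$ Let $\mathbb R^{\mathbb N}/\ell_p$ denote the equivalence relation on $\mathbb R^{\mathbb N}$ given by $x-y\in\ell_p$. All spaces are real, and $L_r=L_r[0,1]$ with respect to Lebesgue measure. Theorem. For all $r,s,p,q\in[1,+\infty)$ the following hold. (1) $E(\ell_r,p)\le_B E(L_r,p)$. (2) $E(\ell_p,p)\sim_B\mathbb R^{\mathbb N}/\ell_p\le_B E(\ell_r,p)$. (3) $E(\ell_2,p)\sim_B E(L_2,p)\le_B E(L_r,p)$. (4) If $s\le r\le 2$, then $E(L_r,p)\le_B E(L_s,p)$. (5) If $\frac rp=\frac sq$ and $p\le q$, then $E(\ell_r,p)\le_B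 E(\ell_s,q)$ and $E(L_r,p)\le_B E(L_s,q)$. -/

import Mathlib

open MeasureTheory

/-- An exponent in `[1, ∞)`, seen as an extended nonnegative real, is at least `1`. -/
instance fact_one_le_ofReal (p : ℝ) [hp : Fact (1 ≤ p)] : Fact (1 ≤ ENNReal.ofReal p) :=
  ⟨ENNReal.one_le_ofReal.2 hp.out⟩

instance fact_one_le_two_real : Fact ((1 : ℝ) ≤ 2) := ⟨one_le_two⟩

/-- `E` is Borel reducible to `F`: there is a Borel function `θ : X → Y` with
`x E y ↔ θ x F θ y`. Here `X` and `Y` carry their Borel σ-algebras. -/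
def BorelReducible {X Y : Type*} [TopologicalSpace X] [TopologicalSpace Y]
    (E : Setoid X) (F : Setoid Y) : Prop :=
  ∃ θ : X → Y, Measurable[borel X, borel Y] θ ∧ ∀ x y : X, E x y ↔ F (θ x) (θ y)

/-- `E` and `F` are Borel bireducible. -/
def BorelBireducible {X Y : Type*} [TopologicalSpace X] [TopologicalSpace Y]
    (E : Setoid X) (F : Setoid Y) : Prop :=
  BorelReducible E F ∧ BorelReducible F E

theorem summable_dist_rpow_trans {M : Type*} [MetricSpace M] {p : ℝ} (hp : 1 ≤ p)
    {x y z : ℕ → M} (hxy : Summable fun n => dist (x n) (y n) ^ p)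
    (hyz : Summable fun n => dist (y n) (z n) ^ p) :
    Summable fun n => dist (x n) (z n) ^ p := by
  have h := (hxy.add hyz).mul_left ((2 : ℝ) ^ (p - 1))
  refine Summable.of_nonneg_of_le (fun n => by positivity) (fun n => ?_) h
  have h₂ : (dist (x n) (y n) + dist (y n) (z n)) ^ p ≤
      2 ^ (p - 1) * (dist (x n) (y n) ^ p + dist (y n) (z n) ^ p) := by
    have := NNReal.rpow_add_le_mul_rpow_add_rpow (nndist (x n) (y n)) (nndist (y n) (z n)) hp
    exact_mod_cast this
  exact (Real.rpow_le_rpow dist_nonneg (dist_triangle _ _ _) (by linarith)).trans h₂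

/-- The equivalence relation `E(M, p)` on `M^ℕ`:
`x` and `y` are equivalent iff `∑ₙ d(x(n), y(n))^p < ∞`. -/
def ERel (M : Type*) [MetricSpace M] (p : ℝ) [hp : Fact (1 ≤ p)] : Setoid (ℕ → M) where
  r x y := Summable fun n => dist (x n) (y n) ^ p
  iseqv :=
    { refl := fun x => by
        have : p ≠ 0 := by have := hp.out; positivity
        simp [Real.zero_rpow this]
      symm := fun {x y} h => by simpa only [dist_comm] using h
      trans := fun h₁ h₂ => summable_dist_rpow_trans hp.out h₁ h₂ }

/-- The equivalence relation `ℝ^ℕ / ℓ_p` on `ℝ^ℕ`: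
`x` and `y` are equivalent iff `x - y ∈ ℓ_p`. -/
def realSeqModEll (p : ℝ) : Setoid (ℕ → ℝ) where
  r x y := Memℓp (fun n => x n - y n) (ENNReal.ofReal p)
  iseqv :=
    { refl := fun x => by
        simp only [sub_self]
        exact zero_memℓp
      symm := fun {x y} h => by
        have := h.neg
        simpa [Pi.neg_def] using this
      trans := fun {x y z} h₁ h₂ => by
        have := h₁.add h₂
        simpa [Pi.add_def] using this }

/-- The real Banach space `ℓ_r`. -/
abbrev SeqL (r : ℝ) : Type := lp (fun _ : ℕ => ℝ) (ENNReal.ofReal r)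

/-- The real Banach space `L_r = L_r[0,1]`, with Lebesgue measure on `[0,1]`. -/
abbrev FunL (r : ℝ) : Type :=
  Lp ℝ (ENNReal.ofReal r) ((volume : Measure ℝ).restrict (Set.Icc 0 1))

open MeasureTheory ProbabilityTheory Filter
open scoped ENNReal NNReal Topology

/-! Apart from the trivial ones and those involving `ℝ^ℕ/ℓ_p`, the basic reductions apply one map
`T` in every coordinate. If `d(Tx,Ty)^s` is comparable to `d(x,y)^r` and `r/p = s/q`, then
`d(Tx,Ty)^q` is comparable to `d(x,y)^p`, so the two series converge together
(`BorelReducible.of_edist_rpow`). What remains is to find embeddings. The relation `ℝ^ℕ/ℓ_p` is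
handled by flattening `ℕ × ℕ` and by placing reals on one axis of `ℓ_r`.

Two auxiliary spaces go into `L_s[0,1]`, up to a constant: `L_s(Ω; ℓ_s)`, by weighting `Ω × ℕ`
(`exists_map_FunL_of_tsum`), and `L_s(Ω; ℓ_2)`, since `∑ aᵢgᵢ` with independent standard Gaussians
`gᵢ` is Gaussian of variance `∑ aᵢ²` (`exists_map_FunL_of_tsum_sq`). With `Ω` a point these give (1)
and (3).

For (5), `ℝ` with the metric `|a-b|^(r/s)`, `r < s`, embeds in `ℓ_s` by rescaled sines and cosines
at all dyadic frequencies (`exists_snowflake`); this map is applied to each coordinate or pointwise.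

For (4), a discrete substitute for `r`-stable variables is used: take `2^k` independent copies of
`f` scaled by `2^(-k/r)`, for every `k`. For `s < r < 2` the `L_s(ℓ_2)` norm of this family is
equivalent to `‖f‖_r` (`exists_copiesNorm_bounds`). -/

/-! ### Convergence of series in extended nonnegative reals -/

theorem summable_iff_tsum_ofReal_ne_top {f : ℕ → ℝ} (hf : ∀ n, 0 ≤ f n) :
    Summable f ↔ ∑' n, ENNReal.ofReal (f n) ≠ ∞ := by
  refine ⟨fun h => h.tsum_ofReal_ne_top, fun h => ?_⟩
  simpa [ENNReal.toReal_ofReal, hf] using ENNReal.summable_toReal h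

theorem eRel_iff {M : Type*} [MetricSpace M] {p : ℝ} [Fact (1 ≤ p)] {x y : ℕ → M} :
    ERel M p x y ↔ ∑' n, edist (x n) (y n) ^ p ≠ ∞ := by
  have hp : 1 ≤ p := Fact.out
  have : ∀ n, edist (x n) (y n) ^ p = ENNReal.ofReal (dist (x n) (y n) ^ p) := fun n => by
    rw [edist_dist, ENNReal.ofReal_rpow_of_nonneg dist_nonneg (by linarith)]
  simp only [this]
  exact summable_iff_tsum_ofReal_ne_top fun n => by positivity

theorem realSeqModEll_iff {p : ℝ} [Fact (1 ≤ p)] {x y : ℕ → ℝ} :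
    realSeqModEll p x y ↔ ∑' n, ‖x n - y n‖ₑ ^ p ≠ ∞ := by
  have hp : 1 ≤ p := Fact.out
  have hp0 : 0 < (ENNReal.ofReal p).toReal := by
    rw [ENNReal.toReal_ofReal] <;> linarith
  have : ∀ n, ‖x n - y n‖ₑ ^ p = ENNReal.ofReal (‖x n - y n‖ ^ p) := fun n => by
    rw [← ofReal_norm, ENNReal.ofReal_rpow_of_nonneg (norm_nonneg _) (by linarith)]
  simp only [this]
  rw [← summable_iff_tsum_ofReal_ne_top fun n => by positivity]
  change Memℓp _ _ ↔ _
  rw [memℓp_gen_iff hp0, ENNReal.toReal_ofReal (by linarith)]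

/-! ### Reductions induced by a single map -/

/-- A map which distorts suitable powers of distances by bounded factors induces a reduction. -/
theorem BorelReducible.of_edist_rpow {M N : Type*} [MetricSpace M] [MetricSpace N]
    {r s p q : ℝ} [Fact (1 ≤ p)] [Fact (1 ≤ q)] (hr : 1 ≤ r) (hs : 1 ≤ s)
    (hrs : r / p = s / q) {c C : ℝ≥0∞} (hc : c ≠ 0) (hC : C ≠ ∞) (T : M → N)
    (hlow : ∀ x y, c * edist x y ^ r ≤ edist (T x) (T y) ^ s)
    (hupp : ∀ x y, edist (T x) (T y) ^ s ≤ C * edist x y ^ r) :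
    BorelReducible (ERel M p) (ERel N q) := by
  have hp : 1 ≤ p := Fact.out
  have hq : 1 ≤ q := Fact.out
  -- Raising the hypotheses to the power `q / s` turns the exponents `r`, `s` into `p`, `q`.
  have hqs : 0 < q / s := by positivity
  have hrp : r * (q / s) = p := by
    field_simp at hrs ⊢; linarith
  have hsq : s * (q / s) = q := by field_simp
  have hlow' : ∀ x y, c ^ (q / s) * edist x y ^ p ≤ edist (T x) (T y) ^ q := fun x y => by
    have := ENNReal.rpow_le_rpow (hlow x y) hqs.le
    rwa [ENNReal.mul_rpow_of_nonneg _ _ hqs.le, ← ENNReal.rpow_mul, ← ENNReal.rpow_mul, hrp,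
      hsq] at this
  have hupp' : ∀ x y, edist (T x) (T y) ^ q ≤ C ^ (q / s) * edist x y ^ p := fun x y => by
    have := ENNReal.rpow_le_rpow (hupp x y) hqs.le
    rwa [ENNReal.mul_rpow_of_nonneg _ _ hqs.le, ← ENNReal.rpow_mul, ← ENNReal.rpow_mul, hrp,
      hsq] at this
  -- The upper bound makes `T` Hölder of exponent `r / s`, hence the induced map is continuous and
  -- so Borel.
  have hcont : Continuous T := by
    have h : HolderWith (C ^ (1 / s)).toNNReal (r / s).toNNReal T := fun x y => by
      have h1 : 0 < 1 / s := by positivity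
      have := ENNReal.rpow_le_rpow (hupp x y) h1.le
      rw [ENNReal.mul_rpow_of_nonneg _ _ h1.le, ← ENNReal.rpow_mul, ← ENNReal.rpow_mul,
        mul_one_div_cancel (by positivity), ENNReal.rpow_one, mul_one_div] at this
      rwa [ENNReal.coe_toNNReal (ENNReal.rpow_ne_top_of_nonneg h1.le hC),
        Real.coe_toNNReal _ (by positivity)]
    exact h.continuous (by positivity)
  refine ⟨fun x n => T (x n), ?_, fun x y => ?_⟩
  · borelize (ℕ → M) (ℕ → N)
    exact (continuous_pi fun n => hcont.comp (continuous_apply n)).measurable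
  · rw [eRel_iff, eRel_iff]
    constructor
    · intro h
      refine ne_top_of_le_ne_top ?_ (ENNReal.tsum_le_tsum fun n => hupp' (x n) (y n))
      rw [ENNReal.tsum_mul_left]
      exact ENNReal.mul_ne_top (ENNReal.rpow_ne_top_of_nonneg hqs.le hC) h
    · intro h h'
      refine h (top_unique ?_)
      refine le_trans ?_ (ENNReal.tsum_le_tsum fun n => hlow' (x n) (y n))
      rw [ENNReal.tsum_mul_left, h', ENNReal.mul_top]
      simp [hc, hqs.le]

theorem BorelReducible.refl {X : Type*} [TopologicalSpace X] (E : Setoid X) :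
    BorelReducible E E :=
  ⟨id, measurable_id, fun _ _ => Iff.rfl⟩

theorem BorelReducible.trans {X Y Z : Type*} [TopologicalSpace X] [TopologicalSpace Y]
    [TopologicalSpace Z] {E : Setoid X} {F : Setoid Y} {G : Setoid Z}
    (h₁ : BorelReducible E F) (h₂ : BorelReducible F G) : BorelReducible E G := by
  obtain ⟨θ₁, hm₁, h₁⟩ := h₁
  obtain ⟨θ₂, hm₂, h₂⟩ := h₂
  borelize X Y Z
  exact ⟨θ₂ ∘ θ₁, hm₂.comp hm₁, fun x y => (h₁ x y).trans (h₂ _ _)⟩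

/-! ### Powers of distances in `ℓ_r` and `L_r` -/

theorem lp_edist_rpow {ι : Type*} {r : ℝ} [Fact (1 ≤ r)]
    (x y : lp (fun _ : ι => ℝ) (ENNReal.ofReal r)) :
    edist x y ^ r = ∑' i, ‖x i - y i‖ₑ ^ r := by
  have hr : 1 ≤ r := Fact.out
  have hr' : (ENNReal.ofReal r).toReal = r := ENNReal.toReal_ofReal (by linarith)
  have h0 : 0 < (ENNReal.ofReal r).toReal := by linarith
  have hs := lp.hasSum_norm h0 (x - y)
  rw [hr'] at hs
  rw [edist_dist, dist_eq_norm, ENNReal.ofReal_rpow_of_nonneg (norm_nonneg _) (by linarith),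
    ← hs.tsum_eq, ENNReal.ofReal_tsum_of_nonneg (fun i => by positivity) hs.summable]
  refine tsum_congr fun i => ?_
  rw [← ofReal_norm, ENNReal.ofReal_rpow_of_nonneg (norm_nonneg _) (by linarith)]
  rfl

theorem memℓp_of_tsum_enorm_rpow_ne_top {ι : Type*} {r : ℝ} (hr : 1 ≤ r) {x : ι → ℝ}
    (h : ∑' i, ‖x i‖ₑ ^ r ≠ ∞) : Memℓp x (ENNReal.ofReal r) := by
  have hr' : (ENNReal.ofReal r).toReal = r := ENNReal.toReal_ofReal (by linarith)
  refine memℓp_gen ?_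
  rw [hr']
  refine (ENNReal.summable_toReal h).congr fun i => ?_
  rw [← ENNReal.toReal_rpow, toReal_enorm]

theorem tsum_enorm_lp_rpow_ne_top {ι : Type*} {r : ℝ} [Fact (1 ≤ r)]
    (x : lp (fun _ : ι => ℝ) (ENNReal.ofReal r)) : ∑' i, ‖x i‖ₑ ^ r ≠ ∞ := by
  have hr : 1 ≤ r := Fact.out
  have := lp_edist_rpow x 0
  simp only [lp.coeFn_zero, Pi.zero_apply, sub_zero] at this
  rw [← this]
  exact ENNReal.rpow_ne_top_of_nonneg (by linarith) (edist_ne_top _ _)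

theorem Lp_edist_rpow {Ω : Type*} [MeasurableSpace Ω] {μ : Measure Ω} {r : ℝ} [Fact (1 ≤ r)]
    (f g : Lp ℝ (ENNReal.ofReal r) μ) :
    edist f g ^ r = ∫⁻ ω, ‖f ω - g ω‖ₑ ^ r ∂μ := by
  have hr : 1 ≤ r := Fact.out
  have hr' : (ENNReal.ofReal r).toReal = r := ENNReal.toReal_ofReal (by linarith)
  rw [Lp.edist_def, eLpNorm_eq_lintegral_rpow_enorm_toReal (by simp; linarith) (by simp), hr',
    ← ENNReal.rpow_mul, one_div_mul_cancel (by linarith), ENNReal.rpow_one]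
  rfl

theorem lintegral_enorm_Lp_rpow_ne_top {Ω : Type*} [MeasurableSpace Ω] {μ : Measure Ω} {r : ℝ}
    [Fact (1 ≤ r)] (f : Lp ℝ (ENNReal.ofReal r) μ) : ∫⁻ ω, ‖f ω‖ₑ ^ r ∂μ ≠ ∞ := by
  have hr : 1 ≤ r := Fact.out
  have hr' : (ENNReal.ofReal r).toReal = r := ENNReal.toReal_ofReal (by linarith)
  have := lintegral_rpow_enorm_lt_top_of_eLpNorm_lt_top (by simp; linarith) (by simp)
    (Lp.memLp f).2
  rw [hr'] at this
  exact this.ne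

theorem memLp_of_lintegral_enorm_rpow_ne_top {Ω : Type*} [MeasurableSpace Ω] {μ : Measure Ω}
    {r : ℝ} (hr : 1 ≤ r) {f : Ω → ℝ} (hf : AEStronglyMeasurable f μ)
    (h : ∫⁻ ω, ‖f ω‖ₑ ^ r ∂μ ≠ ∞) : MemLp f (ENNReal.ofReal r) μ := by
  have hr' : (ENNReal.ofReal r).toReal = r := ENNReal.toReal_ofReal (by linarith)
  refine ⟨hf, ?_⟩
  rw [eLpNorm_lt_top_iff_lintegral_rpow_enorm_lt_top (by simp; linarith) (by simp), hr']
  exact h.lt_top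

/-- Functions on a standard Borel probability space can be transplanted to `[0, 1]`. -/
theorem exists_isometry_FunL {Ω : Type*} [MeasurableSpace Ω] [StandardBorelSpace Ω]
    (ν : Measure Ω) [IsProbabilityMeasure ν] (s : ℝ) [Fact (1 ≤ s)] :
    ∃ J : Lp ℝ (ENNReal.ofReal s) ν → FunL s, Isometry J := by
  have : Nonempty Ω := nonempty_of_isProbabilityMeasure ν
  obtain ⟨f, hf, hfν⟩ := ν.exists_measurable_map_eq
  have h01 : (0 : ℝ) ≤ 1 := zero_le_one
  -- The projection only extends `f` from the unit interval to all of `ℝ`; its values outside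
  -- `[0,1]` are irrelevant.
  have hproj : Measurable (Set.projIcc (0 : ℝ) 1 h01) := continuous_projIcc.measurable
  have h : MeasurePreserving (fun t => f (Set.projIcc (0 : ℝ) 1 h01 t))
      ((volume : Measure ℝ).restrict (Set.Icc 0 1)) ν := by
    refine ⟨hf.comp hproj, ?_⟩
    rw [← unitInterval.measurePreserving_coe.map_eq]
    refine (Measure.map_map (hf.comp hproj) measurable_subtype_coe).trans ?_
    convert hfν using 2
    · rfl
    · exact funext fun t => congrArg f (Set.projIcc_val h01 t)
  exact ⟨_, (Lp.compMeasurePreservingₗᵢ ℝ _ h).isometry⟩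

/-! ### Comparison with `ℝ^ℕ/ℓ_p` -/

theorem borelReducible_SeqL_realSeqModEll (p : ℝ) [Fact (1 ≤ p)] :
    BorelReducible (ERel (SeqL p) p) (realSeqModEll p) := by
  refine ⟨fun x n => x n.unpair.1 n.unpair.2, ?_, fun x y => ?_⟩
  · have : Continuous fun (x : ℕ → SeqL p) (n : ℕ) => x n.unpair.1 n.unpair.2 :=
      continuous_pi fun n => ((continuous_apply _).comp
        (lp.uniformContinuous_coe (E := fun _ : ℕ => ℝ)).continuous).comp
          (continuous_apply n.unpair.1)
    borelize (ℕ → SeqL p) (ℕ → ℝ)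
    exact this.measurable
  · rw [eRel_iff, realSeqModEll_iff]
    simp only [lp_edist_rpow]
    rw [← ENNReal.tsum_prod (f := fun a b => ‖x a b - y a b‖ₑ ^ p),
      ← Nat.pairEquiv.symm.tsum_eq]
    rfl

theorem borelReducible_realSeqModEll_SeqL (r p : ℝ) [Fact (1 ≤ r)] [Fact (1 ≤ p)] :
    BorelReducible (realSeqModEll p) (ERel (SeqL r) p) := by
  have hr : 1 ≤ r := Fact.out
  have hi : Isometry fun t : ℝ => (lp.single (ENNReal.ofReal r) (0 : ℕ) t : SeqL r) :=
    lp.isometry_single (E := fun _ : ℕ => ℝ) 0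
  refine ⟨fun x n => lp.single (ENNReal.ofReal r) 0 (x n), ?_, fun x y => ?_⟩
  · borelize (ℕ → SeqL r) (ℕ → ℝ)
    exact (continuous_pi fun n => hi.continuous.comp (continuous_apply n)).measurable
  · rw [eRel_iff, realSeqModEll_iff]
    have h : ∀ n, edist (lp.single (ENNReal.ofReal r) (0 : ℕ) (x n) : SeqL r)
        (lp.single (ENNReal.ofReal r) 0 (y n)) = ‖x n - y n‖ₑ := fun n => by
      rw [← edist_eq_enorm_sub]
      exact hi (x n) (y n)
    simp only [h]

/-! ### Embedding `L_s(Ω; ℓ_s)` into `L_s[0,1]` -/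

/-- The geometric distribution on `ℕ` with weights `2⁻¹, 2⁻², …`. -/
noncomputable def geomHalf : Measure ℕ :=
  Measure.sum fun k : ℕ => ((2 : ℝ≥0∞)⁻¹ ^ (k + 1)) • Measure.dirac k

theorem lintegral_geomHalf (f : ℕ → ℝ≥0∞) :
    ∫⁻ k, f k ∂geomHalf = ∑' k, (2 : ℝ≥0∞)⁻¹ ^ (k + 1) * f k := by
  simp [geomHalf, lintegral_sum_measure, lintegral_smul_measure]

instance isProbabilityMeasure_geomHalf : IsProbabilityMeasure geomHalf :=
  ⟨by
    rw [← lintegral_one, lintegral_geomHalf]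
    simp only [mul_one]
    rw [ENNReal.tsum_geometric_add_one]
    simp only [ENNReal.one_sub_inv_two, inv_inv]
    exact ENNReal.inv_mul_cancel (by simp) (by simp)⟩

theorem measurable_geomHalf_weight_mul {Ω : Type*} [MeasurableSpace Ω] (s : ℝ) {b : ℕ → Ω → ℝ}
    (hb : ∀ i, Measurable (b i)) :
    Measurable fun z : Ω × ℕ => (2 : ℝ) ^ ((z.2 + 1 : ℝ) / s) * b z.2 z.1 :=
  measurable_from_prod_countable_left fun i => by
    have := hb i
    dsimp only
    fun_prop

/-- The factor `2^((i+1)/s)`, once raised to the power `s`, cancels the mass `2^(-(i+1))` of the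
point `i`. -/
theorem lintegral_prod_geomHalf {Ω : Type*} [MeasurableSpace Ω] (ν : Measure Ω)
    [IsProbabilityMeasure ν] {s : ℝ} (hs : 1 ≤ s) {b : ℕ → Ω → ℝ} (hb : ∀ i, Measurable (b i)) :
    ∫⁻ z, ‖(2 : ℝ) ^ ((z.2 + 1 : ℝ) / s) * b z.2 z.1‖ₑ ^ s ∂(ν.prod geomHalf) =
      ∫⁻ ω, ∑' i, ‖b i ω‖ₑ ^ s ∂ν := by
  rw [lintegral_prod _ ((measurable_geomHalf_weight_mul s hb).enorm.pow_const s).aemeasurable]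
  refine lintegral_congr fun ω => ?_
  rw [lintegral_geomHalf]
  refine tsum_congr fun i => ?_
  have h2 : ‖(2 : ℝ) ^ ((i + 1 : ℝ) / s)‖ₑ ^ s = 2 ^ (i + 1) := by
    rw [← ofReal_norm, ENNReal.ofReal_rpow_of_nonneg (norm_nonneg _) (by linarith),
      Real.norm_of_nonneg (by positivity), ← Real.rpow_mul (by norm_num),
      div_mul_cancel₀ _ (by linarith)]
    norm_cast
  rw [enorm_mul, ENNReal.mul_rpow_of_nonneg _ _ (by linarith), h2, ← mul_assoc, ← mul_pow,
    ENNReal.inv_mul_cancel (by simp) (by simp), one_pow, one_mul]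

/-- The space `L_s(Ω; ℓ_s)` embeds isometrically into `L_s[0, 1]`. -/
theorem exists_map_FunL_of_tsum {M Ω : Type*} [MeasurableSpace Ω] [StandardBorelSpace Ω]
    (ν : Measure Ω) [IsProbabilityMeasure ν] (s : ℝ) [Fact (1 ≤ s)] (a : M → ℕ → Ω → ℝ)
    (ha : ∀ x i, Measurable (a x i)) (hfin : ∀ x, ∫⁻ ω, ∑' i, ‖a x i ω‖ₑ ^ s ∂ν ≠ ∞) :
    ∃ T : M → FunL s, ∀ x y,
      edist (T x) (T y) ^ s = ∫⁻ ω, ∑' i, ‖a x i ω - a y i ω‖ₑ ^ s ∂ν := by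
  have hs : 1 ≤ s := Fact.out
  obtain ⟨J, hJ⟩ := exists_isometry_FunL (ν.prod geomHalf) s
  have hmem : ∀ x, MemLp (fun z : Ω × ℕ => (2 : ℝ) ^ ((z.2 + 1 : ℝ) / s) * a x z.2 z.1)
      (ENNReal.ofReal s) (ν.prod geomHalf) := fun x => by
    refine memLp_of_lintegral_enorm_rpow_ne_top hs ?_ ?_
    · exact (measurable_geomHalf_weight_mul s (ha x)).aestronglyMeasurable
    · rw [lintegral_prod_geomHalf ν hs (ha x)]
      exact hfin x
  refine ⟨fun x => J (hmem x).toLp, fun x y => ?_⟩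
  rw [hJ, Lp_edist_rpow, ← lintegral_prod_geomHalf ν hs (b := fun i ω => a x i ω - a y i ω)
    fun i => (ha x i).sub (ha y i)]
  refine lintegral_congr_ae ?_
  filter_upwards [(hmem x).coeFn_toLp, (hmem y).coeFn_toLp] with z hx hy
  rw [hx, hy, ← mul_sub]

theorem borelReducible_SeqL_FunL (r p : ℝ) [Fact (1 ≤ r)] [Fact (1 ≤ p)] :
    BorelReducible (ERel (SeqL r) p) (ERel (FunL r) p) := by
  have hr : 1 ≤ r := Fact.out
  obtain ⟨T, hT⟩ := exists_map_FunL_of_tsum (Measure.dirac ()) r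
    (fun (x : SeqL r) i _ => x i) (fun _ _ => measurable_const)
    (fun x => by simpa using tsum_enorm_lp_rpow_ne_top x)
  have hT' : ∀ x y, edist (T x) (T y) ^ r = 1 * edist x y ^ r := fun x y => by
    rw [hT, lp_edist_rpow]
    simp
  exact .of_edist_rpow hr hr rfl one_ne_zero ENNReal.one_ne_top T (fun x y => (hT' x y).ge)
    fun x y => (hT' x y).le

/-! ### Snowflake embeddings and the change of exponents -/

section Snowflake

variable {r s : ℝ} [Fact (1 ≤ r)] [Fact (1 ≤ s)] {c C : ℝ≥0∞} {φ : ℕ → ℝ → ℝ}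

/-- The doubly indexed family `φ k (x i)` is flattened by the pairing function; summing the scalar
bounds over `i` gives the distortion, and `φ k 0 = 0` puts the image in `ℓ_s`. -/
theorem borelReducible_SeqL_of_snowflake {p q : ℝ} [Fact (1 ≤ p)] [Fact (1 ≤ q)]
    (hrs : r / p = s / q) (hc : c ≠ 0) (hC : C ≠ ∞) (hφ0 : ∀ k, φ k 0 = 0)
    (hlow : ∀ a b, c * ‖a - b‖ₑ ^ r ≤ ∑' k, ‖φ k a - φ k b‖ₑ ^ s)
    (hupp : ∀ a b, ∑' k, ‖φ k a - φ k b‖ₑ ^ s ≤ C * ‖a - b‖ₑ ^ r) :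
    BorelReducible (ERel (SeqL r) p) (ERel (SeqL s) q) := by
  have hr : 1 ≤ r := Fact.out
  have hs : 1 ≤ s := Fact.out
  have hsum : ∀ f : ℕ → ℕ → ℝ≥0∞, ∑' n : ℕ, f n.unpair.1 n.unpair.2 = ∑' (i) (k), f i k := by
    intro f
    rw [← ENNReal.tsum_prod (f := f), ← Nat.pairEquiv.symm.tsum_eq]
    rfl
  have hmem : ∀ x : SeqL r, Memℓp (fun n : ℕ => φ n.unpair.2 (x n.unpair.1))
      (ENNReal.ofReal s) := fun x => by
    refine memℓp_of_tsum_enorm_rpow_ne_top hs ?_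
    rw [hsum fun i k => ‖φ k (x i)‖ₑ ^ s]
    refine ne_top_of_le_ne_top (ENNReal.mul_ne_top hC (tsum_enorm_lp_rpow_ne_top x)) ?_
    rw [← ENNReal.tsum_mul_left]
    refine ENNReal.tsum_le_tsum fun i => ?_
    simpa [hφ0] using hupp (x i) 0
  have hT : ∀ x y : SeqL r, edist (⟨_, hmem x⟩ : SeqL s) ⟨_, hmem y⟩ ^ s =
      ∑' (i) (k), ‖φ k (x i) - φ k (y i)‖ₑ ^ s := fun x y => by
    rw [lp_edist_rpow, ← hsum fun i k => ‖φ k (x i) - φ k (y i)‖ₑ ^ s]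
  refine .of_edist_rpow hr hs hrs hc hC (fun x => (⟨_, hmem x⟩ : SeqL s)) (fun x y => ?_)
    fun x y => ?_
  · rw [hT, lp_edist_rpow, ← ENNReal.tsum_mul_left]
    exact ENNReal.tsum_le_tsum fun i => hlow _ _
  · rw [hT, lp_edist_rpow, ← ENNReal.tsum_mul_left]
    exact ENNReal.tsum_le_tsum fun i => hupp _ _

theorem borelReducible_FunL_of_snowflake {p q : ℝ} [Fact (1 ≤ p)] [Fact (1 ≤ q)]
    (hrs : r / p = s / q) (hc : c ≠ 0) (hC : C ≠ ∞) (hφ : ∀ k, Measurable (φ k))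
    (hφ0 : ∀ k, φ k 0 = 0)
    (hlow : ∀ a b, c * ‖a - b‖ₑ ^ r ≤ ∑' k, ‖φ k a - φ k b‖ₑ ^ s)
    (hupp : ∀ a b, ∑' k, ‖φ k a - φ k b‖ₑ ^ s ≤ C * ‖a - b‖ₑ ^ r) :
    BorelReducible (ERel (FunL r) p) (ERel (FunL s) q) := by
  have hr : 1 ≤ r := Fact.out
  have hs : 1 ≤ s := Fact.out
  have : IsProbabilityMeasure ((volume : Measure ℝ).restrict (Set.Icc 0 1)) := ⟨by simp⟩
  have hmeas : ∀ f : FunL r, Measurable f := fun f => (Lp.stronglyMeasurable f).measurable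
  obtain ⟨T, hT⟩ := exists_map_FunL_of_tsum ((volume : Measure ℝ).restrict (Set.Icc 0 1)) s
    (fun (f : FunL r) k t => φ k (f t)) (fun f k => (hφ k).comp (hmeas f)) (fun f => by
      refine ne_top_of_le_ne_top (ENNReal.mul_ne_top hC (lintegral_enorm_Lp_rpow_ne_top f)) ?_
      rw [← lintegral_const_mul' _ _ hC]
      refine lintegral_mono fun t => ?_
      simpa [hφ0] using hupp (f t) 0)
  refine .of_edist_rpow hr hs hrs hc hC T (fun x y => ?_) fun x y => ?_
  · rw [hT, Lp_edist_rpow]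
    exact (lintegral_const_mul_le _ _).trans (lintegral_mono fun t => hlow _ _)
  · rw [hT, Lp_edist_rpow, ← lintegral_const_mul' _ _ hC]
    exact lintegral_mono fun t => hupp _ _

end Snowflake

/-- Sums of a two-sided power-law bump over the dyadic scales are bounded uniformly in the
starting scale. -/
theorem exists_tsum_dyadic_min_rpow_le {α β : ℝ} (hα : 0 < α) (hβ : 0 < β) :
    ∃ C : ℝ≥0∞, C ≠ ∞ ∧ ∀ t : ℝ, 0 < t →
      ∑' k : ℤ, ENNReal.ofReal (min (((2 : ℝ) ^ k * t) ^ α) (((2 : ℝ) ^ k * t) ^ (-β))) ≤ C := by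
  -- For `2^m ≤ t < 2^(m+1)`, the increasing power is bounded at the right endpoint and the
  -- decreasing one at the left, so the majorant depends only on `k + m` and the shift by `m`
  -- removes `t`.
  set F : ℤ → ℝ := fun n => min (((2 : ℝ) ^ (n + 1)) ^ α) (((2 : ℝ) ^ n) ^ (-β)) with hF
  have hF0 : ∀ n, 0 ≤ F n := fun n => by positivity
  have hsum : Summable F := by
    refine Summable.of_nat_of_neg_add_one ?_ ?_
    · refine Summable.of_nonneg_of_le (fun n => hF0 _) (fun n => min_le_right _ _) ?_
      have : ∀ n : ℕ, ((2 : ℝ) ^ (n : ℤ)) ^ (-β) = ((2 : ℝ) ^ (-β)) ^ n := fun n => by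
        rw [zpow_natCast, ← Real.rpow_natCast, ← Real.rpow_mul (by norm_num), mul_comm,
          Real.rpow_mul (by norm_num), Real.rpow_natCast]
      simp only [this]
      exact summable_geometric_of_lt_one (by positivity)
        (Real.rpow_lt_one_of_one_lt_of_neg (by norm_num) (by linarith))
    · refine Summable.of_nonneg_of_le (fun n => hF0 _) (fun n => min_le_left _ _) ?_
      have : ∀ n : ℕ, ((2 : ℝ) ^ (-((n : ℤ) + 1) + 1)) ^ α = ((2 : ℝ) ^ (-α)) ^ n := fun n => by
        rw [show -((n : ℤ) + 1) + 1 = -n by ring, ← Real.rpow_intCast,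
          ← Real.rpow_mul (by norm_num), ← Real.rpow_natCast, ← Real.rpow_mul (by norm_num)]
        push_cast
        ring_nf
      simp only [this]
      exact summable_geometric_of_lt_one (by positivity)
        (Real.rpow_lt_one_of_one_lt_of_neg (by norm_num) (by linarith))
  refine ⟨∑' n, ENNReal.ofReal (F n), hsum.tsum_ofReal_ne_top, fun t ht => ?_⟩
  obtain ⟨m, hm⟩ := exists_mem_Ico_zpow ht (by norm_num : (1 : ℝ) < 2)
  rw [← (Equiv.addRight m).tsum_eq fun n => ENNReal.ofReal (F n)]
  refine ENNReal.tsum_le_tsum fun k => ENNReal.ofReal_le_ofReal ?_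
  have h2 : (0 : ℝ) < 2 ^ k := by positivity
  simp only [Equiv.coe_addRight, hF]
  refine min_le_min ?_ ?_
  · refine Real.rpow_le_rpow (by positivity) ?_ hα.le
    rw [add_assoc, zpow_add₀ two_ne_zero]
    exact mul_le_mul_of_nonneg_left hm.2.le h2.le
  · refine Real.rpow_le_rpow_of_nonpos (by positivity) ?_ (by linarith)
    rw [zpow_add₀ two_ne_zero]
    exact mul_le_mul_of_nonneg_left hm.1 h2.le

theorem sq_cos_sub_cos_add_sq_sin_sub_sin (x y : ℝ) :
    (Real.cos x - Real.cos y) ^ 2 + (Real.sin x - Real.sin y) ^ 2 = 2 - 2 * Real.cos (x - y) := by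
  rw [Real.cos_sub]
  nlinarith [Real.sin_sq_add_cos_sq x, Real.sin_sq_add_cos_sq y]

theorem cos_le_cos_one {x : ℝ} (h1 : 1 ≤ |x|) (h2 : |x| ≤ 2) : Real.cos x ≤ Real.cos 1 := by
  rw [← Real.cos_abs x]
  exact Real.cos_le_cos_of_nonneg_of_le_pi (by norm_num) (h2.trans Real.two_le_pi) h1

/-- The coordinates of a snowflake embedding of `ℝ`: `2^{-kr/s} (cos (2^k t) - 1)` and
`2^{-kr/s} sin (2^k t)` over all dyadic scales `k`. -/
noncomputable def snowflakeCoord (r s : ℝ) (k : ℤ ⊕ ℤ) (t : ℝ) : ℝ :=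
  k.elim (fun k => ((2 : ℝ) ^ k) ^ (-(r / s)) * (Real.cos (2 ^ k * t) - 1))
    fun k => ((2 : ℝ) ^ k) ^ (-(r / s)) * Real.sin (2 ^ k * t)

theorem measurable_snowflakeCoord (r s : ℝ) (k : ℤ ⊕ ℤ) : Measurable (snowflakeCoord r s k) := by
  rcases k with k | k
  · change Measurable fun t => ((2 : ℝ) ^ k) ^ (-(r / s)) * (Real.cos (2 ^ k * t) - 1)
    fun_prop
  · change Measurable fun t => ((2 : ℝ) ^ k) ^ (-(r / s)) * Real.sin (2 ^ k * t)
    fun_prop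

/-- Put `t = 2^k|a-b|`. The `s`-th power of the weight is `2^(-kr) = |a-b|^r t^(-r)`, and the
increment of `g` is at most `min(t, 2)`. -/
theorem enorm_rpow_le_of_lipschitz_bounded {r s : ℝ} (hr : 1 ≤ r) (hs : 1 ≤ s) {g : ℝ → ℝ}
    (hg1 : ∀ x y, |g x - g y| ≤ 2) (hg2 : ∀ x y, |g x - g y| ≤ |x - y|) (k : ℤ) {a b : ℝ}
    (hab : 0 < |a - b|) :
    ‖((2 : ℝ) ^ k) ^ (-(r / s)) * (g (2 ^ k * a) - g (2 ^ k * b))‖ₑ ^ s ≤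
      2 ^ s * ‖a - b‖ₑ ^ r * ENNReal.ofReal
        (min (((2 : ℝ) ^ k * |a - b|) ^ (s - r)) (((2 : ℝ) ^ k * |a - b|) ^ (-r))) := by
  have h2 : (0 : ℝ) < 2 ^ k := by positivity
  have hu : 0 < (2 : ℝ) ^ k * |a - b| := by positivity
  have e1 : (2 : ℝ≥0∞) ^ s = ENNReal.ofReal (2 ^ s) := by
    rw [← ENNReal.ofReal_rpow_of_nonneg (by norm_num) (by linarith)]; simp
  rw [← ofReal_norm, ← ofReal_norm, ENNReal.ofReal_rpow_of_nonneg (norm_nonneg _) (by linarith),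
    ENNReal.ofReal_rpow_of_nonneg (norm_nonneg _) (by linarith), e1,
    ← ENNReal.ofReal_mul (by positivity), ← ENNReal.ofReal_mul (by positivity)]
  refine ENNReal.ofReal_le_ofReal ?_
  rw [norm_mul, Real.norm_of_nonneg (by positivity), Real.mul_rpow (by positivity) (norm_nonneg _),
    ← Real.rpow_mul h2.le, Real.norm_eq_abs, Real.norm_eq_abs, neg_mul,
    div_mul_cancel₀ _ (by linarith)]
  have e2 : ((2 : ℝ) ^ k) ^ (-r) = |a - b| ^ r * (2 ^ k * |a - b|) ^ (-r) := by
    rw [Real.mul_rpow h2.le hab.le, Real.rpow_neg hab.le, mul_left_comm,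
      mul_inv_cancel₀ (by positivity), mul_one]
  have e3 : ((2 : ℝ) ^ k * |a - b|) ^ (s - r) =
      (2 ^ k * |a - b|) ^ s * (2 ^ k * |a - b|) ^ (-r) := by
    rw [← Real.rpow_add hu, ← sub_eq_add_neg]
  rw [e2, e3, mul_comm (2 ^ s : ℝ), mul_assoc, mul_assoc]
  refine mul_le_mul_of_nonneg_left ?_ (by positivity)
  have hd : |g (2 ^ k * a) - g (2 ^ k * b)| ≤ 2 ^ k * |a - b| := by
    refine (hg2 _ _).trans_eq ?_
    rw [← mul_sub, abs_mul, abs_of_pos h2]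
  have hpos : 0 ≤ ((2 : ℝ) ^ k * |a - b|) ^ (-r) := by positivity
  rw [mul_min_of_nonneg _ _ (by positivity : (0 : ℝ) ≤ 2 ^ s)]
  refine le_min ?_ ?_
  · have h := Real.rpow_le_rpow (abs_nonneg _) hd (by linarith : 0 ≤ s)
    have h1 : (1 : ℝ) ≤ 2 ^ s := Real.one_le_rpow (by norm_num) (by linarith)
    calc _ ≤ 1 * ((2 ^ k * |a - b|) ^ s * (2 ^ k * |a - b|) ^ (-r)) := by
          rw [one_mul, mul_comm]; gcongr
      _ ≤ _ := by gcongr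
  · rw [mul_comm]
    gcongr
    exact hg1 _ _

/-- At frequency `2^(-m)` the weight to the power `s` is `2^(mr)`, which is at least
`2^(-r)|a-b|^r`. -/
theorem mul_enorm_rpow_le_of_sq_le {r s δ : ℝ} (hr : 1 ≤ r) (hs : 1 ≤ s) (hδ : 0 ≤ δ) {m : ℤ}
    {a b u : ℝ} (hm : |a - b| ≤ 2 ^ (m + 1)) (hu : δ ≤ u ^ 2) :
    ENNReal.ofReal (δ ^ (s / 2) * 2 ^ (-r)) * ‖a - b‖ₑ ^ r ≤
      ‖((2 : ℝ) ^ (-m)) ^ (-(r / s)) * u‖ₑ ^ s := by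
  have h2 : (0 : ℝ) < 2 ^ m := by positivity
  rw [← ofReal_norm, ← ofReal_norm, ENNReal.ofReal_rpow_of_nonneg (norm_nonneg _) (by linarith),
    ENNReal.ofReal_rpow_of_nonneg (norm_nonneg _) (by linarith),
    ← ENNReal.ofReal_mul (by positivity)]
  refine ENNReal.ofReal_le_ofReal ?_
  have e : (((2 : ℝ) ^ (-m)) ^ (-(r / s))) ^ s = (2 ^ m) ^ r := by
    rw [zpow_neg, ← Real.rpow_mul (by positivity), neg_mul, div_mul_cancel₀ _ (by linarith),
      Real.inv_rpow h2.le, Real.rpow_neg h2.le, inv_inv]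
  have h3 : (0 : ℝ) ≤ (2 ^ (-m)) ^ (-(r / s)) := by positivity
  rw [norm_mul, Real.norm_of_nonneg h3, Real.mul_rpow h3 (norm_nonneg _),
    e, mul_assoc, mul_comm]
  refine mul_le_mul ?_ ?_ (by positivity) (by positivity)
  · have h := Real.rpow_le_rpow (abs_nonneg _) hm (by linarith : 0 ≤ r)
    rw [zpow_add_one₀ two_ne_zero, Real.mul_rpow h2.le zero_le_two] at h
    rw [Real.norm_eq_abs, Real.rpow_neg zero_le_two, inv_mul_le_iff₀ (by positivity), mul_comm]
    exact h
  · have h := Real.rpow_le_rpow hδ hu (by linarith : 0 ≤ s / 2)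
    rwa [← sq_abs, ← Real.rpow_natCast, ← Real.rpow_mul (abs_nonneg _), Nat.cast_ofNat,
      mul_div_cancel₀ _ two_ne_zero] at h

/-- The single frequency comparable to `1/|a-b|` already gives the lower bound. In the upper bound
low frequencies contribute like `t^(s-r)` and high ones like `t^(-r)`, with `t = 2^k|a-b|`, so `r <
s` makes both tails geometric. -/
theorem exists_snowflake {r s : ℝ} (hr : 1 ≤ r) (hrs : r < s) :
    ∃ (φ : ℕ → ℝ → ℝ) (c C : ℝ≥0∞), c ≠ 0 ∧ C ≠ ∞ ∧ (∀ k, Measurable (φ k)) ∧ (∀ k, φ k 0 = 0) ∧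
      (∀ a b, c * ‖a - b‖ₑ ^ r ≤ ∑' k, ‖φ k a - φ k b‖ₑ ^ s) ∧
      ∀ a b, ∑' k, ‖φ k a - φ k b‖ₑ ^ s ≤ C * ‖a - b‖ₑ ^ r := by
  have hs : 1 ≤ s := hr.trans hrs.le
  obtain ⟨C, hC, hbound⟩ := exists_tsum_dyadic_min_rpow_le (sub_pos.2 hrs) (by linarith : 0 < r)
  let e : ℕ ≃ ℤ ⊕ ℤ := (Denumerable.eqv (ℤ ⊕ ℤ)).symm
  have hsum : ∀ a b, ∑' k, ‖snowflakeCoord r s (e k) a - snowflakeCoord r s (e k) b‖ₑ ^ s =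
      ∑' k : ℤ, ‖((2 : ℝ) ^ k) ^ (-(r / s)) * (Real.cos (2 ^ k * a) - Real.cos (2 ^ k * b))‖ₑ ^ s +
      ∑' k : ℤ, ‖((2 : ℝ) ^ k) ^ (-(r / s)) *
        (Real.sin (2 ^ k * a) - Real.sin (2 ^ k * b))‖ₑ ^ s := fun a b => by
    rw [e.tsum_eq fun k => ‖snowflakeCoord r s k a - snowflakeCoord r s k b‖ₑ ^ s,
      Summable.tsum_sum ENNReal.summable ENNReal.summable]
    congr 1
    · refine tsum_congr fun k => ?_
      simp only [snowflakeCoord, Sum.elim_inl, ← mul_sub, sub_sub_sub_cancel_right]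
    · refine tsum_congr fun k => ?_
      simp only [snowflakeCoord, Sum.elim_inr, ← mul_sub]
  have hcos1 : 0 < 1 - Real.cos 1 := by
    linarith [Real.cos_one_le]
  refine ⟨fun k => snowflakeCoord r s (e k),
    ENNReal.ofReal ((1 - Real.cos 1) ^ (s / 2) * 2 ^ (-r)), 2 * 2 ^ s * C, ?_, ?_, fun k => ?_,
    fun k => ?_, fun a b => ?_, fun a b => ?_⟩
  · simp only [ne_eq, ENNReal.ofReal_eq_zero, not_le]
    positivity
  · exact ENNReal.mul_ne_top (ENNReal.mul_ne_top (by simp)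
      (ENNReal.rpow_ne_top_of_nonneg (by linarith) (by simp))) hC
  · exact measurable_snowflakeCoord r s (e k)
  · rcases h : e k with j | j <;> simp [h, snowflakeCoord]
  · rw [hsum]
    rcases eq_or_ne a b with rfl | hab
    · simp [show (0 : ℝ) < r by linarith]
    have hab' : 0 < |a - b| := abs_pos.2 (sub_ne_zero.2 hab)
    obtain ⟨m, hm1, hm2⟩ := exists_mem_Ico_zpow hab' (by norm_num : (1 : ℝ) < 2)
    have h2 : (0 : ℝ) < 2 ^ m := by positivity
    have habs : |(2 : ℝ) ^ (-m) * a - 2 ^ (-m) * b| = |a - b| / 2 ^ m := by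
      rw [← mul_sub, abs_mul, abs_of_pos (by positivity), zpow_neg, inv_mul_eq_div]
    -- The two phases differ by an amount in `[1, 2]`, inside `[0, π]`. The squared cosine and sine
    -- increments then sum to at least `2(1 - cos 1)`, so one of them is at least `1 - cos 1`.
    have hcos := cos_le_cos_one (x := (2 : ℝ) ^ (-m) * a - 2 ^ (-m) * b)
      (by rwa [habs, one_le_div h2])
      (by rw [habs, div_le_iff₀ h2, mul_comm, ← zpow_add_one₀ two_ne_zero]; exact hm2.le)
    have hsq := sq_cos_sub_cos_add_sq_sin_sub_sin ((2 : ℝ) ^ (-m) * a) (2 ^ (-m) * b)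
    rcases le_total (1 - Real.cos 1)
      ((Real.cos (2 ^ (-m) * a) - Real.cos (2 ^ (-m) * b)) ^ 2) with h | h
    · exact ((mul_enorm_rpow_le_of_sq_le hr hs hcos1.le hm2.le h).trans
        (ENNReal.le_tsum (-m))).trans le_self_add
    · have h' : 1 - Real.cos 1 ≤ (Real.sin (2 ^ (-m) * a) - Real.sin (2 ^ (-m) * b)) ^ 2 := by
        linarith
      exact ((mul_enorm_rpow_le_of_sq_le hr hs hcos1.le hm2.le h').trans
        (ENNReal.le_tsum (-m))).trans le_add_self
  · rw [hsum]
    rcases eq_or_ne a b with rfl | hab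
    · simp [show (0 : ℝ) < s by linarith]
    have hab' : 0 < |a - b| := abs_pos.2 (sub_ne_zero.2 hab)
    have hb : ∀ g : ℝ → ℝ, (∀ x y, |g x - g y| ≤ 2) → (∀ x y, |g x - g y| ≤ |x - y|) →
        ∑' k : ℤ, ‖((2 : ℝ) ^ k) ^ (-(r / s)) * (g (2 ^ k * a) - g (2 ^ k * b))‖ₑ ^ s ≤
          2 ^ s * ‖a - b‖ₑ ^ r * C := fun g h1 h2 => by
      refine (ENNReal.tsum_le_tsum fun k =>
        enorm_rpow_le_of_lipschitz_bounded hr hs h1 h2 k hab').trans ?_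
      rw [ENNReal.tsum_mul_left]
      gcongr
      exact hbound _ hab'
    refine (add_le_add (hb Real.cos ?_ ?_) (hb Real.sin ?_ ?_)).trans_eq (by ring)
    · exact fun x y => abs_le.2 ⟨by linarith [Real.neg_one_le_cos x, Real.cos_le_one y],
        by linarith [Real.neg_one_le_cos y, Real.cos_le_one x]⟩
    · exact Real.abs_cos_sub_cos_le
    · exact fun x y => abs_le.2 ⟨by linarith [Real.neg_one_le_sin x, Real.sin_le_one y],
        by linarith [Real.neg_one_le_sin y, Real.sin_le_one x]⟩
    · exact Real.abs_sin_sub_sin_le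

theorem borelReducible_of_div_eq_div {r s p q : ℝ} [Fact (1 ≤ r)] [Fact (1 ≤ s)] [Fact (1 ≤ p)]
    [Fact (1 ≤ q)] (hrs : r / p = s / q) (hpq : p ≤ q) :
    BorelReducible (ERel (SeqL r) p) (ERel (SeqL s) q) ∧
      BorelReducible (ERel (FunL r) p) (ERel (FunL s) q) := by
  have hr : 1 ≤ r := Fact.out
  have hs : 1 ≤ s := Fact.out
  have hp : 1 ≤ p := Fact.out
  have hq : 1 ≤ q := Fact.out
  rcases hpq.eq_or_lt with rfl | hpq
  · obtain rfl : r = s := by field_simp at hrs; exact hrs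
    exact ⟨.refl _, .refl _⟩
  · have hlt : r < s := by
      rw [div_eq_div_iff (by positivity) (by positivity)] at hrs
      nlinarith
    obtain ⟨φ, c, C, hc, hC, hφ, hφ0, hlow, hupp⟩ := exists_snowflake hr hlt
    exact ⟨borelReducible_SeqL_of_snowflake hrs hc hC hφ0 hlow hupp,
      borelReducible_FunL_of_snowflake hrs hc hC hφ hφ0 hlow hupp⟩

/-! ### Gaussian series and `L_s(Ω; ℓ_2)` in `L_s[0,1]` -/

/-- The absolute moment of order `s` of the standard Gaussian. -/
noncomputable def gaussMoment (s : ℝ) : ℝ≥0∞ := ∫⁻ x, ‖x‖ₑ ^ s ∂gaussianReal 0 1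

theorem gaussMoment_ne_top {s : ℝ} (hs : 1 ≤ s) : gaussMoment s ≠ ∞ := by
  have h := memLp_id_gaussianReal' (μ := 0) (v := 1) (ENNReal.ofReal s) (by simp)
  have hr' : (ENNReal.ofReal s).toReal = s := ENNReal.toReal_ofReal (by linarith)
  have := lintegral_rpow_enorm_lt_top_of_eLpNorm_lt_top (by simp; linarith) (by simp) h.2
  rw [hr'] at this
  exact this.ne

theorem gaussMoment_ne_zero {s : ℝ} (hs : 1 ≤ s) : gaussMoment s ≠ 0 := by
  intro h
  rw [gaussMoment, lintegral_eq_zero_iff (by fun_prop)] at h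
  have h0 : ∀ᵐ x ∂gaussianReal 0 1, x = 0 := by
    filter_upwards [h] with x hx
    simpa [show 0 < s by linarith] using hx
  have : NullSingletonClass (gaussianReal 0 1) := nullSingletonClass_gaussianReal one_ne_zero
  have h1 : ∀ᵐ x ∂gaussianReal 0 1, x ≠ 0 := by
    simp [ae_iff]
  have : ∀ᵐ x ∂gaussianReal 0 1, False := by
    filter_upwards [h0, h1] with x hx hx'
    exact hx' hx
  simp [IsProbabilityMeasure.ne_zero] at this

theorem lintegral_enorm_rpow_gaussianReal {s : ℝ} (hs : 1 ≤ s) (v : ℝ≥0) :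
    ∫⁻ x, ‖x‖ₑ ^ s ∂gaussianReal 0 v = gaussMoment s * (v : ℝ≥0∞) ^ (s / 2) := by
  have hv : gaussianReal 0 v = (gaussianReal 0 1).map (NNReal.sqrt v * · : ℝ → ℝ) := by
    rw [gaussianReal_map_const_mul]
    congr 1
    · simp
    · ext; simp
  rw [hv, lintegral_map (by fun_prop) (by fun_prop), gaussMoment, mul_comm,
    ← lintegral_const_mul _ (by fun_prop)]
  refine lintegral_congr fun x => ?_
  rw [enorm_mul, ENNReal.mul_rpow_of_nonneg _ _ (by linarith)]
  congr 1
  have : ‖(NNReal.sqrt v : ℝ)‖ₑ = (v : ℝ≥0∞) ^ (1 / 2 : ℝ) := by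
    rw [← ENNReal.coe_rpow_of_nonneg _ (by norm_num), ← NNReal.sqrt_eq_rpow]
    exact NNReal.enorm_eq _
  rw [this, ← ENNReal.rpow_mul]
  congr 1
  ring

section

variable {ι : Type*}

/-- The law of a sequence of independent standard Gaussians. -/
noncomputable def gaussPi (ι : Type*) : Measure (ι → ℝ) :=
  Measure.infinitePi fun _ : ι => gaussianReal 0 1

instance : IsProbabilityMeasure (gaussPi ι) := by unfold gaussPi; infer_instance

theorem gaussPi_map_sum (c : ι → ℝ) (F : Finset ι) :
    (gaussPi ι).map (fun x => ∑ i ∈ F, c i * x i) = gaussianReal 0 (∑ i ∈ F, ‖c i‖₊ ^ 2) := by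
  classical
  induction F using Finset.induction with
  | empty => simp [gaussianReal_zero_var]
  | insert i F hi ih =>
    have hind : iIndepFun (fun i (x : ι → ℝ) => c i * x i) (gaussPi ι) :=
      iIndepFun_infinitePi (X := fun i t => c i * t) fun i => by fun_prop
    have h := (hind.indepFun_finsetSum_of_notMem (fun i => by fun_prop) hi).symm
    have hone : (gaussPi ι).map (fun x => c i * x i) = gaussianReal 0 (‖c i‖₊ ^ 2) := by
      have : (fun x : ι → ℝ => c i * x i) = (c i * ·) ∘ fun x => x i := rfl
      rw [this, ← Measure.map_map (by fun_prop) (by fun_prop), gaussPi,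
        Measure.infinitePi_map_eval, gaussianReal_map_const_mul]
      congr 1
      · simp
      · ext; simp
    have hsum : (∑ j ∈ F, fun x : ι → ℝ => c j * x j) = fun x => ∑ j ∈ F, c j * x j := by
      ext; simp
    rw [hsum] at h
    have := gaussianReal_add_gaussianReal_of_indepFun h hone ih
    rw [Finset.sum_insert hi, ← add_zero (0 : ℝ), ← this]
    congr 1
    ext x
    simp [Finset.sum_insert hi]

theorem lintegral_gaussPi_sum {s : ℝ} (hs : 1 ≤ s) (c : ι → ℝ) (F : Finset ι) :
    ∫⁻ x, ‖∑ i ∈ F, c i * x i‖ₑ ^ s ∂gaussPi ι =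
      gaussMoment s * (∑ i ∈ F, ‖c i‖ₑ ^ 2) ^ (s / 2) := by
  have := lintegral_enorm_rpow_gaussianReal hs (∑ i ∈ F, ‖c i‖₊ ^ 2)
  rw [← gaussPi_map_sum, lintegral_map (by fun_prop) (by fun_prop)] at this
  rw [this]
  push_cast
  rfl

variable {Ω : Type*} [MeasurableSpace Ω] {ν : Measure Ω}
  {b : ι → Ω → ℝ}

theorem lintegral_prod_gaussPi_sum [SFinite ν] {s : ℝ} (hs : 1 ≤ s) (hb : ∀ i, Measurable (b i))
    (F : Finset ι) :
    ∫⁻ z, ‖∑ i ∈ F, b i z.1 * z.2 i‖ₑ ^ s ∂ν.prod (gaussPi ι) =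
      gaussMoment s * ∫⁻ ω, (∑ i ∈ F, ‖b i ω‖ₑ ^ 2) ^ (s / 2) ∂ν := by
  rw [lintegral_prod _ (by fun_prop), ← lintegral_const_mul _ (by fun_prop)]
  exact lintegral_congr fun ω => lintegral_gaussPi_sum hs (fun i => b i ω) F

theorem tendsto_lintegral_sum_rpow [Countable ι] {s : ℝ} (hs : 1 ≤ s) (hb : ∀ i, Measurable (b i))
    (hfin : ∫⁻ ω, (∑' i, ‖b i ω‖ₑ ^ 2) ^ (s / 2) ∂ν ≠ ∞) :
    Tendsto (fun F : Finset ι => ∫⁻ ω, (∑ i ∈ F, ‖b i ω‖ₑ ^ 2) ^ (s / 2) ∂ν) atTop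
      (𝓝 (∫⁻ ω, (∑' i, ‖b i ω‖ₑ ^ 2) ^ (s / 2) ∂ν)) := by
  refine tendsto_lintegral_filter_of_dominated_convergence _
    (Eventually.of_forall fun F => by fun_prop)
    (Eventually.of_forall fun F => Eventually.of_forall fun ω => ?_) hfin
    (Eventually.of_forall fun ω => ?_)
  · exact ENNReal.rpow_le_rpow (ENNReal.sum_le_tsum F) (by linarith)
  · exact (ENNReal.continuous_rpow_const.tendsto _).comp ENNReal.summable.hasSum

/-- This supplies the Cauchy criterion for the Gaussian series: tails vanish almost everywhere and
are dominated by the full sum. -/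
theorem tendsto_lintegral_tsum_compl_rpow [Countable ι] {s : ℝ} (hs : 1 ≤ s)
    (hb : ∀ i, Measurable (b i))
    (hfin : ∫⁻ ω, (∑' i, ‖b i ω‖ₑ ^ 2) ^ (s / 2) ∂ν ≠ ∞) :
    Tendsto (fun F : Finset ι => ∫⁻ ω, (∑' i : {i // i ∉ F}, ‖b i ω‖ₑ ^ 2) ^ (s / 2) ∂ν) atTop
      (𝓝 0) := by
  have hs2 : 0 < s / 2 := by linarith
  rw [← lintegral_zero (μ := ν)]
  refine tendsto_lintegral_filter_of_dominated_convergence _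
    (Eventually.of_forall fun F => by fun_prop)
    (Eventually.of_forall fun F => Eventually.of_forall fun ω => ?_) hfin ?_
  · exact ENNReal.rpow_le_rpow (ENNReal.tsum_comp_le_tsum_of_injective
      Subtype.val_injective fun i => ‖b i ω‖ₑ ^ 2) hs2.le
  · filter_upwards [ae_lt_top (by fun_prop) hfin] with ω hω
    have h : ∑' i, ‖b i ω‖ₑ ^ 2 ≠ ∞ := fun h => by simp [h, hs2] at hω
    have := ((ENNReal.continuous_rpow_const (y := s / 2)).tendsto _).comp
      (ENNReal.tendsto_tsum_compl_atTop_zero h)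
    rwa [ENNReal.zero_rpow_of_pos hs2] at this

/-- The space `L_s(Ω; ℓ_2)` embeds into `L_s[0, 1]`, by means of independent Gaussians. -/
theorem exists_map_FunL_of_tsum_sq [Countable ι] {M : Type*} [StandardBorelSpace Ω] (ν : Measure Ω)
    [IsProbabilityMeasure ν] (s : ℝ) [Fact (1 ≤ s)] (a : M → ι → Ω → ℝ)
    (ha : ∀ x i, Measurable (a x i))
    (hfin : ∀ x, ∫⁻ ω, (∑' i, ‖a x i ω‖ₑ ^ 2) ^ (s / 2) ∂ν ≠ ∞)
    (hfin' : ∀ x y, ∫⁻ ω, (∑' i, ‖a x i ω - a y i ω‖ₑ ^ 2) ^ (s / 2) ∂ν ≠ ∞) :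
    ∃ T : M → FunL s, ∀ x y, edist (T x) (T y) ^ s =
      gaussMoment s * ∫⁻ ω, (∑' i, ‖a x i ω - a y i ω‖ₑ ^ 2) ^ (s / 2) ∂ν := by
  have hs : 1 ≤ s := Fact.out
  have hs2 : 0 ≤ s / 2 := by linarith
  obtain ⟨J, hJ⟩ := exists_isometry_FunL (ν.prod (gaussPi ι)) s
  have hmem : ∀ x i, MemLp (fun z : Ω × (ι → ℝ) => a x i z.1 * z.2 i) (ENNReal.ofReal s)
      (ν.prod (gaussPi ι)) := fun x i => by
    have := ha x i
    refine memLp_of_lintegral_enorm_rpow_ne_top hs (by fun_prop) ?_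
    have h := lintegral_prod_gaussPi_sum (ν := ν) hs (ha x) {i}
    simp only [Finset.sum_singleton] at h
    rw [h]
    refine ENNReal.mul_ne_top (gaussMoment_ne_top hs) (ne_top_of_le_ne_top (hfin x) ?_)
    exact lintegral_mono fun ω => ENNReal.rpow_le_rpow (ENNReal.le_tsum i) hs2
  set Z : M → ι → Lp ℝ (ENNReal.ofReal s) (ν.prod (gaussPi ι)) := fun x i => (hmem x i).toLp
  have hsumnorm : ∀ (c : ι → Ω → ℝ) (_ : ∀ i, Measurable (c i))
      (W : ι → Lp ℝ (ENNReal.ofReal s) (ν.prod (gaussPi ι)))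
      (_ : ∀ i, W i =ᵐ[ν.prod (gaussPi ι)] fun z => c i z.1 * z.2 i) (F : Finset ι),
      ‖∑ i ∈ F, W i‖ₑ ^ s = gaussMoment s * ∫⁻ ω, (∑ i ∈ F, ‖c i ω‖ₑ ^ 2) ^ (s / 2) ∂ν := by
    intro c hc W hW F
    rw [← lintegral_prod_gaussPi_sum hs hc, ← edist_zero_right, Lp_edist_rpow]
    refine lintegral_congr_ae ?_
    filter_upwards [ae_all_iff.2 hW, Lp.coeFn_zero ℝ (ENNReal.ofReal s) (ν.prod (gaussPi ι)),
      Lp.coeFn_finsetSum F W] with z h1 h2 h3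
    rw [h2, h3]
    simp [h1]
  have hsummable : ∀ x, Summable (Z x) := fun x => by
    classical
    rw [summable_iff_vanishing_norm]
    intro ε hε
    have hlim := ENNReal.Tendsto.const_mul (tendsto_lintegral_tsum_compl_rpow hs (ha x) (hfin x))
      (Or.inr (gaussMoment_ne_top hs))
    rw [mul_zero] at hlim
    obtain ⟨F, hF⟩ := (hlim.eventually_lt_const
      (show (0 : ℝ≥0∞) < ENNReal.ofReal ε ^ s from by positivity)).exists
    refine ⟨F, fun t ht => ?_⟩
    have h1 := hsumnorm (a x) (ha x) (Z x) (fun i => (hmem x i).coeFn_toLp) t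
    have h2 : ‖∑ i ∈ t, Z x i‖ₑ ^ s < ENNReal.ofReal ε ^ s := by
      rw [h1]
      refine lt_of_le_of_lt ?_ hF
      gcongr with ω
      rw [← Finset.sum_subtype_of_mem (fun i => ‖a x i ω‖ₑ ^ 2)
        fun i hi => Finset.disjoint_left.1 ht hi]
      exact ENNReal.sum_le_tsum _
    have h3 := (ENNReal.rpow_lt_rpow_iff (by linarith)).1 h2
    rwa [← ofReal_norm, ENNReal.ofReal_lt_ofReal_iff hε] at h3
  refine ⟨fun x => J (∑' i, Z x i), fun x y => ?_⟩
  rw [hJ, edist_eq_enorm_sub, ← (hsummable x).tsum_sub (hsummable y)]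
  have hW : ∀ i, ↑(Z x i - Z y i) =ᵐ[ν.prod (gaussPi ι)]
      fun z => (a x i z.1 - a y i z.1) * z.2 i := fun i => by
    filter_upwards [(hmem x i).coeFn_toLp, (hmem y i).coeFn_toLp, Lp.coeFn_sub (Z x i) (Z y i)]
      with z h1 h2 h3
    rw [h3, Pi.sub_apply, h1, h2, sub_mul]
  have hc : ∀ i, Measurable fun ω => a x i ω - a y i ω := fun i => (ha x i).sub (ha y i)
  -- The norms of the partial sums have two limits: the norm of the whole series by continuity, and
  -- the square-function integral by dominated convergence.
  have hl1 := (ENNReal.continuous_rpow_const (y := s)).tendsto _ |>.comp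
    (((hsummable x).sub (hsummable y)).hasSum.enorm)
  have hl2 := ENNReal.Tendsto.const_mul (tendsto_lintegral_sum_rpow hs hc (hfin' x y))
      (Or.inr (gaussMoment_ne_top hs))
  refine tendsto_nhds_unique hl1 (hl2.congr fun F => ?_)
  exact (hsumnorm _ hc _ hW F).symm

end

/-! ### Hilbert space: `ℓ_2`, `L_2` and `L_r` -/

theorem SeqL_two_tsum_sq (x y : SeqL 2) (r : ℝ) :
    (∑' i, ‖x i - y i‖ₑ ^ 2) ^ (r / 2) = edist x y ^ r := by
  have h := lp_edist_rpow x y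
  simp only [ENNReal.rpow_two] at h
  rw [← h, ← ENNReal.rpow_two, ← ENNReal.rpow_mul, mul_div_cancel₀ _ two_ne_zero]

theorem exists_map_SeqL_two_FunL (r : ℝ) [Fact (1 ≤ r)] :
    ∃ T : SeqL 2 → FunL r, ∀ x y, edist (T x) (T y) ^ r = gaussMoment r * edist x y ^ r := by
  have hr : 1 ≤ r := Fact.out
  have hfin : ∀ x y : SeqL 2, ∫⁻ _, (∑' i, ‖x i - y i‖ₑ ^ 2) ^ (r / 2) ∂Measure.dirac () ≠ ∞ :=
    fun x y => by
      rw [SeqL_two_tsum_sq]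
      simpa using ENNReal.rpow_ne_top_of_nonneg (by linarith) (edist_ne_top x y)
  obtain ⟨T, hT⟩ := exists_map_FunL_of_tsum_sq (Measure.dirac ()) r
    (fun (x : SeqL 2) i _ => x i) (fun _ _ => measurable_const)
    (fun x => by simpa using hfin x 0) hfin
  refine ⟨T, fun x y => ?_⟩
  rw [hT, SeqL_two_tsum_sq]
  simp

theorem borelReducible_SeqL_two_FunL (r p : ℝ) [Fact (1 ≤ r)] [Fact (1 ≤ p)] :
    BorelReducible (ERel (SeqL 2) p) (ERel (FunL r) p) := by
  have hr : 1 ≤ r := Fact.out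
  obtain ⟨T, hT⟩ := exists_map_SeqL_two_FunL r
  exact .of_edist_rpow hr hr rfl (gaussMoment_ne_zero hr) (gaussMoment_ne_top hr) T
    (fun x y => (hT x y).ge) fun x y => (hT x y).le

/-- Distinct vectors are at distance `√2`, so the balls of radius `1/2` around them are disjoint. -/
theorem Orthonormal.countable_of_separableSpace {𝕜 E ι : Type*} [RCLike 𝕜] [NormedAddCommGroup E]
    [InnerProductSpace 𝕜 E] [TopologicalSpace.SeparableSpace E] {v : ι → E}
    (hv : Orthonormal 𝕜 v) : Countable ι := by
  have hdist : ∀ i j, i ≠ j → 1 < dist (v i) (v j) := fun i j hij => by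
    have h := norm_sub_sq (𝕜 := 𝕜) (v i) (v j)
    rw [hv.1, hv.1, hv.2 hij] at h
    rw [dist_eq_norm]
    have h2 : ‖v i - v j‖ ^ 2 = 2 := by rw [h]; norm_num
    nlinarith [norm_nonneg (v i - v j)]
  refine (Pairwise.countable_of_isOpen_disjoint (s := fun i => Metric.ball (v i) (1 / 2))
    (fun i j hij => Metric.ball_disjoint_ball ?_) (fun i => Metric.isOpen_ball)
    fun i => ⟨v i, Metric.mem_ball_self (by norm_num)⟩)
  linarith [hdist i j hij]

/-- A separable real Hilbert space embeds isometrically into `ℓ_2`. -/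
theorem exists_isometry_lp_nat_two (E : Type*) [NormedAddCommGroup E] [InnerProductSpace ℝ E]
    [CompleteSpace E] [TopologicalSpace.SeparableSpace E] :
    ∃ T : E → lp (fun _ : ℕ => ℝ) 2, Isometry T := by
  obtain ⟨w, b, hb⟩ := exists_hilbertBasis ℝ E
  have : Countable w := b.orthonormal.countable_of_separableSpace
  obtain ⟨f, hf⟩ := exists_injective_nat w
  have hv : Orthonormal ℝ fun i : w => (lp.single 2 (f i) (1 : ℝ) : lp (fun _ : ℕ => ℝ) 2) := by
    refine ⟨fun i => by simp [lp.norm_single], fun i j hij => ?_⟩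
    beta_reduce
    rw [lp.inner_single_left]
    simp [hf.ne hij]
  exact ⟨_, hv.orthogonalFamily.linearIsometry.isometry.comp b.repr.isometry⟩

theorem exists_isometry_FunL_two_SeqL : ∃ T : FunL 2 → SeqL 2, Isometry T := by
  -- The exponent is generalised so that `ENNReal.ofReal 2` can be replaced by the literal `2`,
  -- where the inner product lives.
  have key : ∀ (e : ℝ≥0∞) [Fact (1 ≤ e)], e = 2 →
      ∃ T : Lp ℝ e ((volume : Measure ℝ).restrict (Set.Icc 0 1)) → lp (fun _ : ℕ => ℝ) e,
        Isometry T := by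
    rintro e _ rfl
    have : Fact ((2 : ℝ≥0∞) ≠ ∞) := ⟨by simp⟩
    exact exists_isometry_lp_nat_two _
  exact key _ (by simp)

theorem borelReducible_FunL_two_SeqL_two (p : ℝ) [Fact (1 ≤ p)] :
    BorelReducible (ERel (FunL 2) p) (ERel (SeqL 2) p) := by
  obtain ⟨T, hT⟩ := exists_isometry_FunL_two_SeqL
  refine .of_edist_rpow le_rfl le_rfl rfl one_ne_zero ENNReal.one_ne_top T (fun x y => ?_)
    fun x y => ?_
  all_goals rw [hT, one_mul]

/-! ### Weighted independent copies: `L_r` into `L_s` for `s < r < 2` -/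

theorem ENNReal.rpow_tsum_le_tsum_rpow {ι : Type*} {a : ℝ} (ha : 0 < a) (ha1 : a ≤ 1)
    (x : ι → ℝ≥0∞) : (∑' i, x i) ^ a ≤ ∑' i, x i ^ a := by
  classical
  have hfin : ∀ F : Finset ι, (∑ i ∈ F, x i) ^ a ≤ ∑ i ∈ F, x i ^ a := fun F => by
    induction F using Finset.induction with
    | empty => simp [ha]
    | insert i F hi ih =>
      rw [Finset.sum_insert hi, Finset.sum_insert hi]
      exact (ENNReal.rpow_add_le_add_rpow _ _ ha.le ha1).trans (by gcongr)
  refine le_of_tendsto (((ENNReal.continuous_rpow_const (y := a)).tendsto _).comp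
    (ENNReal.summable (f := x)).hasSum) (Eventually.of_forall fun F => ?_)
  exact (hfin F).trans (ENNReal.sum_le_tsum F)

theorem ENNReal.rpow_le_one_add {a : ℝ} (ha : 0 ≤ a) (ha1 : a ≤ 1) (x : ℝ≥0∞) :
    x ^ a ≤ 1 + x := by
  rcases le_total x 1 with h | h
  · exact (ENNReal.rpow_le_one h ha).trans le_self_add
  · calc x ^ a ≤ x ^ (1 : ℝ) := ENNReal.rpow_le_rpow_of_exponent_le h ha1
      _ = x := ENNReal.rpow_one x
      _ ≤ 1 + x := le_add_self

/-- Split at size `1`. The small entries use `S^(s/2) ≤ 1 + S`, the large ones subadditivity of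
`t^(s/2)`; in each range the minimum is the relevant power. -/
theorem ENNReal.rpow_tsum_sq_le {ι : Type*} {s : ℝ} (hs : 0 < s) (hs2 : s ≤ 2)
    (x : ι → ℝ≥0∞) : (∑' i, x i ^ 2) ^ (s / 2) ≤ 1 + ∑' i, min (x i ^ (2 : ℝ)) (x i ^ s) := by
  classical
  have h0 : 0 < s / 2 := by linarith
  have h1 : s / 2 ≤ 1 := by linarith
  have hsplit : ∀ i, x i ^ 2 = (if x i ≤ 1 then x i ^ 2 else 0) +
      if x i ≤ 1 then 0 else x i ^ 2 := fun i => by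
    split_ifs <;> simp
  rw [tsum_congr hsplit, ENNReal.tsum_add]
  refine (ENNReal.rpow_add_le_add_rpow _ _ h0.le h1).trans ((add_le_add
    (ENNReal.rpow_le_one_add h0.le h1 _) (ENNReal.rpow_tsum_le_tsum_rpow h0 h1 _)).trans ?_)
  rw [add_assoc, ← ENNReal.tsum_add]
  refine add_le_add_right (ENNReal.tsum_le_tsum fun i => ?_) _
  split_ifs with h
  · rw [ENNReal.zero_rpow_of_pos h0, add_zero, ENNReal.rpow_two]
    refine le_min le_rfl ?_
    rw [← ENNReal.rpow_two]
    exact ENNReal.rpow_le_rpow_of_exponent_ge h hs2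
  · rw [zero_add, ← ENNReal.rpow_two, ← ENNReal.rpow_mul, mul_div_cancel₀ _ two_ne_zero]
    exact le_min (ENNReal.rpow_le_rpow_of_exponent_le (not_le.1 h).le hs2) le_rfl

/-- The index set with `2 ^ k` indices on level `k`. -/
abbrev DyadicIndex : Type := Σ k : ℕ, Fin (2 ^ k)

theorem tsum_dyadicIndex (f : ℕ → ℝ≥0∞) : ∑' σ : DyadicIndex, f σ.1 = ∑' k, 2 ^ k * f k := by
  rw [ENNReal.tsum_sigma' fun σ : DyadicIndex => f σ.1]
  simp [tsum_fintype]

/-- The weight `2^{-k/r}` of the indices on level `k`. -/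
noncomputable def dyadicWeight (r : ℝ) (k : ℕ) : ℝ := ((2 : ℝ) ^ k) ^ (-(1 / r))

/-- With `v = 2^(-k)|x|^r`, level `k` contributes `|x|^r v^(e/r-1)` for the exponents `e = 2` and `e
= s`. The first power of `v` is positive as `r < 2`, the second negative as `s < r`, so the dyadic
sum is bounded. -/
theorem exists_tsum_min_dyadicWeight_le {r s : ℝ} (hs : 1 ≤ s) (hsr : s < r) (hr2 : r < 2) :
    ∃ C : ℝ≥0∞, C ≠ ∞ ∧ ∀ x : ℝ, ∑' σ : DyadicIndex,
      min (‖dyadicWeight r σ.1 * x‖ₑ ^ (2 : ℝ)) (‖dyadicWeight r σ.1 * x‖ₑ ^ s) ≤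
        C * ‖x‖ₑ ^ r := by
  have hr0 : 0 < r := by linarith
  have hα : 0 < 2 / r - 1 := by rw [sub_pos, one_lt_div hr0]; exact hr2
  have hβ : 0 < 1 - s / r := by rw [sub_pos, div_lt_one hr0]; exact hsr
  obtain ⟨C, hC, hbound⟩ := exists_tsum_dyadic_min_rpow_le hα hβ
  refine ⟨C, hC, fun x => ?_⟩
  rcases eq_or_ne x 0 with rfl | hx
  · simp [hr0, show 0 < s by linarith]
  rw [tsum_dyadicIndex fun k =>
    min (‖dyadicWeight r k * x‖ₑ ^ (2 : ℝ)) (‖dyadicWeight r k * x‖ₑ ^ s)]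
  have hx0 : 0 < |x| := abs_pos.2 hx
  have hy : 0 < |x| ^ r := by positivity
  have hterm : ∀ k : ℕ, 2 ^ k *
      min (‖dyadicWeight r k * x‖ₑ ^ (2 : ℝ)) (‖dyadicWeight r k * x‖ₑ ^ s) =
      ENNReal.ofReal (min (((2 : ℝ) ^ (-(k : ℤ)) * |x| ^ r) ^ (2 / r - 1))
        (((2 : ℝ) ^ (-(k : ℤ)) * |x| ^ r) ^ (-(1 - s / r)))) * ‖x‖ₑ ^ r := fun k => by
    have h2 : (0 : ℝ) < 2 ^ k := by positivity
    set v : ℝ := (2 : ℝ) ^ (-(k : ℤ)) * |x| ^ r with hv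
    have hv0 : 0 < v := by positivity
    have hq : ‖dyadicWeight r k * x‖ = v ^ (1 / r) := by
      rw [hv, Real.mul_rpow (by positivity) hy.le, ← Real.rpow_mul hx0.le,
        mul_one_div_cancel hr0.ne', Real.rpow_one, norm_mul, Real.norm_eq_abs x, dyadicWeight,
        Real.norm_of_nonneg (by positivity), zpow_neg, zpow_natCast, Real.inv_rpow h2.le,
        Real.rpow_neg h2.le]
    have hpow : ∀ e : ℝ, 0 ≤ e →
        2 ^ k * ‖dyadicWeight r k * x‖ₑ ^ e = ENNReal.ofReal (v ^ (e / r - 1)) * ‖x‖ₑ ^ r := by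
      intro e he
      have : (2 : ℝ≥0∞) ^ k = ENNReal.ofReal (2 ^ k) := by
        rw [ENNReal.ofReal_pow (by norm_num)]; simp
      rw [this, ← ofReal_norm, ← ofReal_norm, hq,
        ENNReal.ofReal_rpow_of_nonneg (by positivity) he,
        ENNReal.ofReal_rpow_of_nonneg (norm_nonneg _) hr0.le, ← ENNReal.ofReal_mul h2.le,
        ← ENNReal.ofReal_mul (by positivity), ← Real.rpow_mul hv0.le, Real.rpow_sub hv0,
        Real.rpow_one, Real.norm_eq_abs, one_div_mul_eq_div]
      congr 1
      rw [div_mul_eq_mul_div, eq_div_iff hv0.ne', hv, zpow_neg, zpow_natCast]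
      field_simp
    have hmono : Monotone fun z : ℝ≥0∞ => 2 ^ k * z := fun a b h => by
      dsimp only; gcongr
    have hmono' : Monotone fun z : ℝ≥0∞ => z * ‖x‖ₑ ^ r := fun a b h => by
      dsimp only; gcongr
    rw [hmono.map_min, hpow 2 (by norm_num), hpow s (by linarith), ENNReal.ofReal_mono.map_min,
      hmono'.map_min, neg_sub]
  rw [tsum_congr hterm, ENNReal.tsum_mul_right]
  gcongr
  refine le_trans ?_ (hbound _ hy)
  exact ENNReal.tsum_comp_le_tsum_of_injective (f := fun k : ℕ => -(k : ℤ))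
    (fun a b h => by simpa using h) fun k : ℤ => ENNReal.ofReal
      (min (((2 : ℝ) ^ k * |x| ^ r) ^ (2 / r - 1)) (((2 : ℝ) ^ k * |x| ^ r) ^ (-(1 - s / r))))

/-- Level `k` counts `2^k` times the event `2^k ≤ |x|^r`. The largest such level satisfies `|x|^r <
2 · 2^k`; the summand `1` covers `|x|^r ≤ 1`. -/
theorem enorm_rpow_le_tsum_dyadic {r : ℝ} (hr : 1 ≤ r) (x : ℝ) :
    ‖x‖ₑ ^ r ≤ 1 + 2 * ∑' σ : DyadicIndex,
      Set.indicator {y : ℝ | 1 ≤ ‖dyadicWeight r σ.1 * y‖ₑ} 1 x := by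
  rw [tsum_dyadicIndex fun k => Set.indicator {y : ℝ | 1 ≤ ‖dyadicWeight r k * y‖ₑ} 1 x]
  rcases le_total (|x| ^ r) 1 with h | h
  · refine le_trans ?_ le_self_add
    rw [← ofReal_norm, ENNReal.ofReal_rpow_of_nonneg (norm_nonneg _) (by linarith)]
    exact ENNReal.ofReal_le_one.2 h
  · obtain ⟨k, hk1, hk2⟩ := exists_nat_pow_near h (by norm_num : (1 : ℝ) < 2)
    have h2 : (0 : ℝ) < 2 ^ k := by positivity
    have hmem : x ∈ {y : ℝ | 1 ≤ ‖dyadicWeight r k * y‖ₑ} := by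
      rw [Set.mem_ofPred_eq, ← ofReal_norm, ENNReal.one_le_ofReal, norm_mul, dyadicWeight,
        Real.norm_of_nonneg (by positivity), Real.rpow_neg h2.le, inv_mul_eq_div,
        one_le_div (by positivity), Real.norm_eq_abs]
      have := Real.rpow_le_rpow h2.le hk1 (by positivity : 0 ≤ 1 / r)
      rwa [← Real.rpow_mul (abs_nonneg _), mul_one_div_cancel (by linarith), Real.rpow_one] at this
    calc ‖x‖ₑ ^ r ≤ ENNReal.ofReal (2 ^ (k + 1)) := by
          rw [← ofReal_norm, ENNReal.ofReal_rpow_of_nonneg (norm_nonneg _) (by linarith)]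
          exact ENNReal.ofReal_le_ofReal hk2.le
      _ = 2 * (2 ^ k * Set.indicator {y : ℝ | 1 ≤ ‖dyadicWeight r k * y‖ₑ} 1 x) := by
          rw [Set.indicator_of_mem hmem, ENNReal.ofReal_pow (by norm_num), pow_succ']
          simp
      _ ≤ _ := by
          refine le_trans ?_ le_add_self
          gcongr
          exact ENNReal.le_tsum (f := fun k =>
            2 ^ k * Set.indicator {y : ℝ | 1 ≤ ‖dyadicWeight r k * y‖ₑ} 1 x) k

/-- Inductively, `(1-p)(1+p+S) = 1 + S - p(p+S) ≤ 1 + S`. It bounds the probability that none of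
several independent events occurs. -/
theorem prod_one_sub_le_inv_one_add_sum {ι : Type*} (F : Finset ι) {p : ι → ℝ}
    (h0 : ∀ i, 0 ≤ p i) (h1 : ∀ i, p i ≤ 1) : ∏ i ∈ F, (1 - p i) ≤ (1 + ∑ i ∈ F, p i)⁻¹ := by
  classical
  have hs : ∀ F : Finset ι, 0 ≤ ∑ i ∈ F, p i := fun F => Finset.sum_nonneg fun i _ => h0 i
  have h : (∏ i ∈ F, (1 - p i)) * (1 + ∑ i ∈ F, p i) ≤ 1 := by
    induction F using Finset.induction with
    | empty => simp
    | insert i F hi ih =>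
      rw [Finset.prod_insert hi, Finset.sum_insert hi]
      have hR : 0 ≤ ∏ i ∈ F, (1 - p i) := Finset.prod_nonneg fun i _ => sub_nonneg.2 (h1 i)
      refine le_trans ?_ ih
      rw [mul_comm (1 - p i), mul_assoc]
      refine mul_le_mul_of_nonneg_left ?_ hR
      nlinarith [h0 i, mul_nonneg (h0 i) (hs F)]
  rwa [← one_div, le_div_iff₀ (by linarith [hs F])]

section

variable {E : Type*} [MeasurableSpace E] (μ : Measure E)

/-- The `s`-th power of the norm in `L_s(ℓ_2)` of the sequence of weighted independent copies
of `f`. -/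
noncomputable def copiesNorm (r s : ℝ) (f : E → ℝ) : ℝ≥0∞ :=
  ∫⁻ u, (∑' σ, ‖dyadicWeight r σ.1 * f (u σ)‖ₑ ^ 2) ^ (s / 2)
    ∂Measure.infinitePi fun _ : DyadicIndex => μ

variable {μ} {f : E → ℝ} {r s : ℝ}

theorem lintegral_infinitePi_eval [IsProbabilityMeasure μ] {ι : Type*} {g : E → ℝ≥0∞}
    (hg : Measurable g) (i : ι) :
    ∫⁻ u, g (u i) ∂(Measure.infinitePi fun _ : ι => μ) = ∫⁻ t, g t ∂μ :=
  (measurePreserving_eval_infinitePi (fun _ : ι => μ) i).lintegral_comp hg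

/-- The truncated bound is a sum of functions of single coordinates, each integrated against `μ`; no
independence enters here. -/
theorem exists_copiesNorm_le [IsProbabilityMeasure μ] (hs : 1 ≤ s) (hsr : s < r) (hr2 : r < 2) :
    ∃ C : ℝ≥0∞, C ≠ ∞ ∧ ∀ f : E → ℝ, Measurable f →
      copiesNorm μ r s f ≤ 1 + C * ∫⁻ t, ‖f t‖ₑ ^ r ∂μ := by
  obtain ⟨C, hC, hbound⟩ := exists_tsum_min_dyadicWeight_le hs hsr hr2
  refine ⟨C, hC, fun f hf => ?_⟩
  calc copiesNorm μ r s f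
      ≤ ∫⁻ u, (1 + ∑' σ, min (‖dyadicWeight r σ.1 * f (u σ)‖ₑ ^ (2 : ℝ))
          (‖dyadicWeight r σ.1 * f (u σ)‖ₑ ^ s)) ∂Measure.infinitePi fun _ : DyadicIndex => μ :=
        lintegral_mono fun u => ENNReal.rpow_tsum_sq_le (by linarith) (by linarith) _
    _ = 1 + ∑' σ : DyadicIndex, ∫⁻ t, min (‖dyadicWeight r σ.1 * f t‖ₑ ^ (2 : ℝ))
          (‖dyadicWeight r σ.1 * f t‖ₑ ^ s) ∂μ := by
        rw [lintegral_add_left measurable_const, lintegral_const, measure_univ, one_mul,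
          lintegral_tsum fun σ => by fun_prop]
        congr 1
        refine tsum_congr fun σ => ?_
        exact lintegral_infinitePi_eval (g := fun t => min (‖dyadicWeight r σ.1 * f t‖ₑ ^ (2 : ℝ))
          (‖dyadicWeight r σ.1 * f t‖ₑ ^ s)) (by fun_prop) σ
    _ ≤ 1 + C * ∫⁻ t, ‖f t‖ₑ ^ r ∂μ := by
        rw [← lintegral_tsum fun σ => by fun_prop, ← lintegral_const_mul' _ _ hC]
        gcongr with t
        exact hbound (f t)

/-- The value `3` forces the expected number of copies of weighted size at least `1` to be at least
`1`. By independence some copy is that large with probability at least `1/3`, and then the square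
function is at least `1`. -/
theorem one_third_le_copiesNorm [IsProbabilityMeasure μ] (hr : 1 ≤ r) (hs : 1 ≤ s)
    (hf : Measurable f)
    (h3 : ∫⁻ t, ‖f t‖ₑ ^ r ∂μ = 3) : 3⁻¹ ≤ copiesNorm μ r s f := by
  classical
  set B : DyadicIndex → Set E := fun σ => {t | 1 ≤ ‖dyadicWeight r σ.1 * f t‖ₑ}
  have hB : ∀ σ, MeasurableSet (B σ) := fun σ =>
    measurableSet_le measurable_const (by fun_prop)
  have hsum : 1 ≤ ∑' σ, μ (B σ) := by
    have h : (3 : ℝ≥0∞) ≤ 1 + 2 * ∑' σ, μ (B σ) := by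
      calc (3 : ℝ≥0∞) = ∫⁻ t, ‖f t‖ₑ ^ r ∂μ := h3.symm
        _ ≤ ∫⁻ t, (1 + 2 * ∑' σ, (B σ).indicator 1 t) ∂μ :=
          lintegral_mono fun t => enorm_rpow_le_tsum_dyadic hr (f t)
        _ = 1 + 2 * ∑' σ, μ (B σ) := by
          have hm : ∀ σ, Measurable ((B σ).indicator (1 : E → ℝ≥0∞)) := fun σ =>
            measurable_one.indicator (hB σ)
          rw [lintegral_add_left measurable_const, lintegral_const, measure_univ, one_mul,
            lintegral_const_mul _ (Measurable.tsum hm),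
            lintegral_tsum fun σ => (hm σ).aemeasurable]
          simp only [lintegral_indicator_one (hB _)]
    by_contra! hlt
    have : 1 + 2 * ∑' σ, μ (B σ) < 3 := by
      calc 1 + 2 * ∑' σ, μ (B σ) < 1 + 2 * 1 := by gcongr <;> simp
        _ = 3 := by norm_num
    exact absurd h this.not_ge
  -- A finite subfamily of total mass above `1/2` suffices: none of its events occurs with
  -- probability at most `(1 + 1/2)⁻¹ = 2/3`.
  obtain ⟨F, hF⟩ : ∃ F : Finset DyadicIndex, 2⁻¹ < ∑ σ ∈ F, μ (B σ) := by
    rw [ENNReal.tsum_eq_iSup_sum] at hsum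
    exact lt_iSup_iff.1 (lt_of_lt_of_le (by simp) hsum)
  set P := Measure.infinitePi fun _ : DyadicIndex => μ
  set A : Set (DyadicIndex → E) := (F : Set DyadicIndex).pi fun σ => (B σ)ᶜ
  have hA : MeasurableSet A := .pi F.countable_toSet fun σ _ => (hB σ).compl
  have hPA : P.real A ≤ 2 / 3 := by
    have h1 : P A = ∏ σ ∈ F, μ (B σ)ᶜ := Measure.infinitePi_pi _ fun σ _ => (hB σ).compl
    have h2 : P.real A = ∏ σ ∈ F, (1 - μ.real (B σ)) := by
      rw [measureReal_def, h1, ENNReal.toReal_prod]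
      refine Finset.prod_congr rfl fun σ _ => ?_
      rw [← measureReal_def, probReal_compl_eq_one_sub (hB σ)]
    have h3 : (1 / 2 : ℝ) ≤ ∑ σ ∈ F, μ.real (B σ) := by
      have := (ENNReal.toReal_lt_toReal (by simp)
        (ENNReal.sum_ne_top.2 fun σ _ => measure_ne_top μ _)).2 hF
      rw [ENNReal.toReal_sum fun σ _ => measure_ne_top μ _] at this
      simp only [measureReal_def]
      norm_num at this ⊢
      exact this.le
    rw [h2]
    refine (prod_one_sub_le_inv_one_add_sum F (fun σ => measureReal_nonneg)
      fun σ => measureReal_le_one).trans ?_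
    rw [inv_le_comm₀ (by linarith) (by norm_num)]
    linarith
  have hPA' : 3⁻¹ ≤ P Aᶜ := by
    have : (1 / 3 : ℝ) ≤ P.real Aᶜ := by
      rw [probReal_compl_eq_one_sub hA]; linarith
    rw [← ofReal_measureReal (measure_ne_top P _)]
    refine le_trans ?_ (ENNReal.ofReal_le_ofReal this)
    rw [one_div, ENNReal.ofReal_inv_of_pos (by norm_num)]
    simp
  refine hPA'.trans ?_
  rw [← lintegral_indicator_one hA.compl]
  refine lintegral_mono fun u => ?_
  by_cases hu : u ∈ Aᶜ
  · rw [Set.indicator_of_mem hu, Pi.one_apply]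
    simp only [A, Set.mem_compl_iff, Set.mem_pi, not_forall, not_not] at hu
    obtain ⟨σ, -, hσ⟩ := hu
    refine ENNReal.one_le_rpow ?_ (by linarith)
    refine le_trans ?_ (ENNReal.le_tsum σ)
    exact one_le_pow₀ hσ
  · rw [Set.indicator_of_notMem hu]
    exact zero_le

theorem copiesNorm_const_mul (hs : 0 ≤ s) (hf : Measurable f) (a : ℝ) :
    copiesNorm μ r s (fun t => a * f t) = ‖a‖ₑ ^ s * copiesNorm μ r s f := by
  rw [copiesNorm, copiesNorm, ← lintegral_const_mul _ (by fun_prop)]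
  refine lintegral_congr fun u => ?_
  have : ∀ σ : DyadicIndex, ‖dyadicWeight r σ.1 * (a * f (u σ))‖ₑ ^ 2 =
      ‖a‖ₑ ^ 2 * ‖dyadicWeight r σ.1 * f (u σ)‖ₑ ^ 2 := fun σ => by
    rw [mul_left_comm, enorm_mul, mul_pow]
  rw [tsum_congr this, ENNReal.tsum_mul_left, ENNReal.mul_rpow_of_nonneg _ _ (by linarith),
    ← ENNReal.rpow_two, ← ENNReal.rpow_mul, mul_div_cancel₀ _ two_ne_zero]

/-- Both one-sided estimates are inhomogeneous; rescaling `f` so that the integral equals `3` and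
using `s`-homogeneity makes them multiplicative. -/
theorem exists_copiesNorm_bounds [IsProbabilityMeasure μ] (hs : 1 ≤ s) (hsr : s < r) (hr2 : r < 2) :
    ∃ c C : ℝ≥0∞, c ≠ 0 ∧ C ≠ ∞ ∧ ∀ f : E → ℝ, Measurable f →
      ∫⁻ t, ‖f t‖ₑ ^ r ∂μ ≠ 0 → ∫⁻ t, ‖f t‖ₑ ^ r ∂μ ≠ ∞ →
      c * (∫⁻ t, ‖f t‖ₑ ^ r ∂μ) ^ (s / r) ≤ copiesNorm μ r s f ∧
        copiesNorm μ r s f ≤ C * (∫⁻ t, ‖f t‖ₑ ^ r ∂μ) ^ (s / r) := by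
  have hr0 : 0 < r := by linarith
  have hs0 : 0 < s := by linarith
  obtain ⟨C, hC, hbound⟩ := exists_copiesNorm_le (μ := μ) hs hsr hr2
  refine ⟨3⁻¹ * 3⁻¹ ^ (s / r), (1 + C * 3) * 3⁻¹ ^ (s / r), ?_, ?_, fun f hf h0 hfin => ?_⟩
  · have h3 : (3⁻¹ : ℝ≥0∞) ≠ 0 := by simp
    exact mul_ne_zero h3 (ENNReal.rpow_pos (pos_iff_ne_zero.2 h3) (by simp)).ne'
  · refine ENNReal.mul_ne_top (ENNReal.add_ne_top.2 ⟨ENNReal.one_ne_top,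
      ENNReal.mul_ne_top hC (by simp)⟩) (ENNReal.rpow_ne_top_of_nonneg (by positivity) (by simp))
  set N := ∫⁻ t, ‖f t‖ₑ ^ r ∂μ with hN
  have hN0 : 0 < N.toReal := ENNReal.toReal_pos h0 hfin
  set a : ℝ := (3 / N.toReal) ^ (1 / r) with ha
  have ha0 : 0 < a := by positivity
  have har : ‖a‖ₑ ^ r = 3 * N⁻¹ := by
    rw [← ofReal_norm, ENNReal.ofReal_rpow_of_nonneg (norm_nonneg _) hr0.le,
      Real.norm_of_nonneg ha0.le, ha, ← Real.rpow_mul (by positivity),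
      one_div_mul_cancel hr0.ne', Real.rpow_one, div_eq_mul_inv, ENNReal.ofReal_mul (by norm_num),
      ENNReal.ofReal_inv_of_pos hN0, ENNReal.ofReal_toReal hfin]
    simp
  have hint : ∫⁻ t, ‖a * f t‖ₑ ^ r ∂μ = 3 := by
    simp only [enorm_mul, ENNReal.mul_rpow_of_nonneg _ _ hr0.le]
    rw [lintegral_const_mul _ (by fun_prop), har, mul_assoc, ENNReal.inv_mul_cancel h0 hfin,
      mul_one]
  have has : ‖a‖ₑ ^ s * (3⁻¹ ^ (s / r) * N ^ (s / r)) = 1 := by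
    have : ‖a‖ₑ ^ s = (‖a‖ₑ ^ r) ^ (s / r) := by
      rw [← ENNReal.rpow_mul, mul_div_cancel₀ _ hr0.ne']
    rw [this, har, ← ENNReal.mul_rpow_of_nonneg _ _ (by positivity),
      ← ENNReal.mul_rpow_of_nonneg _ _ (by positivity)]
    have : (3 : ℝ≥0∞) * N⁻¹ * (3⁻¹ * N) = 1 := by
      rw [mul_mul_mul_comm, ENNReal.mul_inv_cancel (by simp) (by simp),
        ENNReal.inv_mul_cancel h0 hfin, one_mul]
    rw [this, ENNReal.one_rpow]
  have hlow := one_third_le_copiesNorm (hs.trans hsr.le) (s := s) hs (hf.const_mul a) hint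
  have hupp := hbound _ (hf.const_mul a)
  rw [hint] at hupp
  rw [copiesNorm_const_mul hs0.le hf] at hlow hupp
  have hself : copiesNorm μ r s f =
      (‖a‖ₑ ^ s * copiesNorm μ r s f) * (3⁻¹ ^ (s / r) * N ^ (s / r)) := by
    rw [mul_right_comm, has, one_mul]
  rw [hself, mul_assoc, mul_assoc (1 + C * 3)]
  exact ⟨by gcongr, by gcongr⟩

end

theorem borelReducible_FunL_of_lt {r s : ℝ} (p : ℝ) [Fact (1 ≤ r)] [Fact (1 ≤ s)] [Fact (1 ≤ p)]
    (hsr : s < r) (hr2 : r < 2) : BorelReducible (ERel (FunL r) p) (ERel (FunL s) p) := by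
  have hr : 1 ≤ r := Fact.out
  have hs : 1 ≤ s := Fact.out
  set μ : Measure ℝ := (volume : Measure ℝ).restrict (Set.Icc 0 1) with hμ
  have : IsProbabilityMeasure μ := ⟨by simp [hμ]⟩
  have hmeas : ∀ f : FunL r, Measurable f := fun f => (Lp.stronglyMeasurable f).measurable
  obtain ⟨C', hC', hle⟩ := exists_copiesNorm_le (μ := μ) hs hsr hr2
  obtain ⟨c, C, hc, hC, hbound⟩ := exists_copiesNorm_bounds (μ := μ) hs hsr hr2
  have hfin : ∀ f : ℝ → ℝ, Measurable f → ∫⁻ t, ‖f t‖ₑ ^ r ∂μ ≠ ∞ → copiesNorm μ r s f ≠ ∞ :=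
    fun f hf h => ne_top_of_le_ne_top
      (ENNReal.add_ne_top.2 ⟨ENNReal.one_ne_top, ENNReal.mul_ne_top hC' h⟩) (hle f hf)
  have hdist : ∀ f g : FunL r, ∫⁻ t, ‖f t - g t‖ₑ ^ r ∂μ ≠ ∞ := fun f g => by
    rw [← Lp_edist_rpow]
    exact ENNReal.rpow_ne_top_of_nonneg (by linarith) (edist_ne_top _ _)
  have hfin' : ∀ f g : FunL r, ∫⁻ u : DyadicIndex → ℝ, (∑' σ, ‖dyadicWeight r σ.1 * f (u σ) -
      dyadicWeight r σ.1 * g (u σ)‖ₑ ^ 2) ^ (s / 2) ∂Measure.infinitePi (fun _ => μ) =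
      copiesNorm μ r s fun t => f t - g t := fun f g => by
    simp only [copiesNorm, mul_sub]
  obtain ⟨T, hT⟩ := exists_map_FunL_of_tsum_sq (Measure.infinitePi fun _ : DyadicIndex => μ) s
    (fun (f : FunL r) σ u => dyadicWeight r σ.1 * f (u σ))
    (fun f σ => ((hmeas f).comp (measurable_pi_apply σ)).const_mul _)
    (fun f => hfin f (hmeas f) (lintegral_enorm_Lp_rpow_ne_top f))
    (fun f g => by
      rw [hfin']
      exact hfin _ ((hmeas f).sub (hmeas g)) (hdist f g))
  -- The rescaling needs a nonzero norm, so coinciding points are treated separately.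
  have hmain : ∀ f g : FunL r, f ≠ g →
      c * edist f g ^ s ≤ copiesNorm μ r s (fun t => f t - g t) ∧
        copiesNorm μ r s (fun t => f t - g t) ≤ C * edist f g ^ s := fun f g hfg => by
    have h0 : ∫⁻ t, ‖f t - g t‖ₑ ^ r ∂μ ≠ 0 := by
      rw [← Lp_edist_rpow]
      simp [hfg, show 0 < r by linarith]
    have h := hbound _ ((hmeas f).sub (hmeas g)) h0 (hdist f g)
    have he : (∫⁻ t, ‖f t - g t‖ₑ ^ r ∂μ) ^ (s / r) = edist f g ^ s := by
      rw [← Lp_edist_rpow, ← ENNReal.rpow_mul, mul_div_cancel₀ _ (by linarith)]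
    exact he ▸ h
  have hs0 : 0 < s := by linarith
  refine .of_edist_rpow hs hs rfl (c := gaussMoment s * c) (C := gaussMoment s * C)
    (mul_ne_zero (gaussMoment_ne_zero hs) hc) (ENNReal.mul_ne_top (gaussMoment_ne_top hs) hC) T
    (fun f g => ?_) fun f g => ?_
  · rcases eq_or_ne f g with rfl | hfg
    · simp [hs0]
    rw [hT, hfin', mul_assoc]
    gcongr
    exact (hmain f g hfg).1
  · rcases eq_or_ne f g with rfl | hfg
    · simp [hs0]
    rw [hT, hfin', mul_assoc]
    gcongr
    exact (hmain f g hfg).2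

theorem borelReducible_FunL_of_le_two {r s : ℝ} (p : ℝ) [Fact (1 ≤ r)] [Fact (1 ≤ s)]
    [Fact (1 ≤ p)] (hsr : s ≤ r) (hr2 : r ≤ 2) :
    BorelReducible (ERel (FunL r) p) (ERel (FunL s) p) := by
  rcases hsr.eq_or_lt with rfl | hsr
  · exact .refl _
  rcases hr2.eq_or_lt with rfl | hr2
  -- At `r = 2` the exponent `2/r - 1` vanishes and the dyadic estimate breaks down; Gaussians
  -- replace it.
  · exact (borelReducible_FunL_two_SeqL_two p).trans (borelReducible_SeqL_two_FunL s p)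
  · exact borelReducible_FunL_of_lt p hsr hr2

theorem mainTheorem8 (r s p q : ℝ) [Fact (1 ≤ r)] [Fact (1 ≤ s)] [Fact (1 ≤ p)]
    [Fact (1 ≤ q)] :
    BorelReducible (ERel (SeqL r) p) (ERel (FunL r) p) ∧
    (BorelBireducible (ERel (SeqL p) p) (realSeqModEll p) ∧
      BorelReducible (realSeqModEll p) (ERel (SeqL r) p)) ∧
    (BorelBireducible (ERel (SeqL 2) p) (ERel (FunL 2) p) ∧
      BorelReducible (ERel (FunL 2) p) (ERel (FunL r) p)) ∧
    (s ≤ r → r ≤ 2 → BorelReducible (ERel (FunL r) p) (ERel (FunL s) p)) ∧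
    (r / p = s / q → p ≤ q →
      BorelReducible (ERel (SeqL r) p) (ERel (SeqL s) q) ∧
      BorelReducible (ERel (FunL r) p) (ERel (FunL s) q)) :=
  ⟨borelReducible_SeqL_FunL r p,
    ⟨⟨borelReducible_SeqL_realSeqModEll p, borelReducible_realSeqModEll_SeqL p p⟩,
      borelReducible_realSeqModEll_SeqL r p⟩,
    ⟨⟨borelReducible_SeqL_FunL 2 p, borelReducible_FunL_two_SeqL_two p⟩,
      (borelReducible_FunL_two_SeqL_two p).trans (borelReducible_SeqL_two_FunL r p)⟩,
    borelReducible_FunL_of_le_two p,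
    borelReducible_of_div_eq_div⟩
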